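/- All Hilbert spaces are finite-dimensional complex Hilbert spaces. A density operator on $\mathcal H_A\otimes\mathcal H^{\otimes n}$ is symmetric relative to $\mathcal H_A$ if it is invariant under conjugation by $\mathrm{id}_A\otimes\pi_{\mathcal H}$ for every $\pi\in S_n$, where $\pi_{\mathcal H}(\phi_1\otimes\cdots\otimes\phi_n)=\phi_{\pi(1)}\otimes\cdots\otimes\phi_{\pi(n)}$. For $m\ge n$, it is $m$-exchangeable relative to $\mathcal H_A$ if it is symmetric relative to $\mathcal H_A$ and is the partial trace, over the last $m-n$ copies of $\mathcal H$, of a density operator on $\mathcal H_A\otimes\mathcal H^{\otimes m}$ that is symmetric relative to $\mathcal H_A$. Put $\delta(U,V)=\frac12\mathrm{tr}|U-V|$ for Hermitian operators and $\delta(P,Q)=\frac12\sum_z|P(z)-Q(z)|$ for distributions on a finite set. A POVM on $\mathcal H$ is a family $\mathfrak Z=\{F_z\}_{z\in\mathcal Z}$, with $\mathcal Z$ finite, of positive semidefinite operators with $\sum_zF_z=\mathrm{id}$. Let $$C_1(\mathfrak Z)=\min\ 2\sum_{z\in\mathcal Z}\mathrm{tr}|F_z^*|,\qquad C_2(\mathfrak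 Z)=\sqrt{|\mathcal Z|}\;C_1(\mathfrak Z),$$ where the minimum is over all families $\{F_z^*\}_{z\in\mathcal Z}$ of Hermitian operators on $\mathcal H$ such that $U=\sum_z\mathrm{tr}(F_zU)F_z^*$ for every Hermitian operator $U$ on $\mathcal H$, and $C_1(\mathfrak Z)=\infty$ if there is no such family (with the convention $\infty\cdot 0=0$). **Theorem.** Let $n,k\ge1$, let $\rho$ be a density operator on $\mathcal H_A\otimes\mathcal H^{\otimes(n+k)}$ that is $(n+2k-1)$-exchangeable relative to $\mathcal H_A$, and let $\mathfrak Z=\{F_z\}_{z\in\mathcal Z}$ be a POVM on $\mathcal H$ with $|\mathcal Z|=t$. Let $\bar{\mathbf z}=(\bar z_1,\dots,\bar z_k)\in\mathcal Z^k$ be the outcome of measuring each of the last $k$ copies of $\mathcal H$ with $\mathfrak Z$, let $\rho_{\bar{\mathbf z}}$ be the state on $\mathcal H_A\otimes\mathcal H^{\otimes n}$ conditioned on this outcome, let $\rho_{\bar{\mathbf z}}^A$ be its partial state on $\mathcal H_A$ and $\rho_{\bar{\mathbf z}}^{1}$ its partial state on a single copy of $\mathcal H$ (the same for each of the $n$ copies).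 Let $Q_{\bar{\mathbf z}}(z)=\frac1k|\{i:\bar z_i=z\}|$. Then for every real $\varepsilon\ge0$, with probability at least $1-k\,e^{-\varepsilon^2/2+1}$ over $\bar{\mathbf z}$, both $$\delta\bigl(\rho_{\bar{\mathbf z}},\ \rho_{\bar{\mathbf z}}^A\otimes(\rho_{\bar{\mathbf z}}^{1})^{\otimes n}\bigr)<\frac{n}{\sqrt k}\,C_2(\mathfrak Z)\,\varepsilon \qquad\text{and}\qquad \delta\bigl((\mathrm{tr}(F_z\rho_{\bar{\mathbf z}}^{1}))_{z\in\mathcal Z},\ Q_{\bar{\mathbf z}}\bigr)<\sqrt{\frac tk}\,\varepsilon .$$ -/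

import Mathlib

open scoped Matrix Kronecker ComplexOrder MatrixOrder ENNReal

/- Finite-dimensional Hilbert spaces are given in orthonormal bases: `ℂ^ι` has basis `ι`, its
operators are the matrices `Matrix ι ι ℂ`, the tensor product of `ℂ^ι` and `ℂ^κ` has basis `ι × κ`
and the tensor power `(ℂ^β)^{⊗ n}` has basis `Fin n → β`. -/

/-- Density operators: positive semidefinite and of trace one. -/
def IsDensity {ι : Type*} [Fintype ι] (ρ : Matrix ι ι ℂ) : Prop :=
  ρ.PosSemidef ∧ ρ.trace = 1

/-- A POVM with outcomes `ζ` on the space with basis `ι`. -/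
structure POVM (ζ ι : Type*) [Fintype ζ] [Fintype ι] [DecidableEq ι] where
  op : ζ → Matrix ι ι ℂ
  posSemidef : ∀ z, (op z).PosSemidef
  sum_eq_one : ∑ z, op z = 1

/-- `tr |U|`, where `|U| = √(U† U)`. -/
noncomputable def traceNorm {ι : Type*} [Fintype ι] [DecidableEq ι] (U : Matrix ι ι ℂ) : ℝ :=
  (CFC.abs U).trace.re

/-- The trace distance `(1/2) tr |U - V|`. -/
noncomputable def traceDist {ι : Type*} [Fintype ι] [DecidableEq ι] (U V : Matrix ι ι ℂ) : ℝ :=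
  1 / 2 * traceNorm (U - V)

/-- The variational distance. -/
noncomputable def varDist {ζ : Type*} [Fintype ζ] (P Q : ζ → ℝ) : ℝ :=
  1 / 2 * ∑ z, |P z - Q z|

/-- The frequency distribution of a tuple. -/
noncomputable def freq {ζ : Type*} [DecidableEq ζ] {k : ℕ} (z : Fin k → ζ) (a : ζ) : ℝ :=
  ((Finset.univ.filter fun i => z i = a).card : ℝ) / k

/-- The probability of the event `E` under a distribution on a finite set with weights `P`. -/
noncomputable def probOf {Ω : Type*} [Fintype Ω] (P : Ω → ℝ) (E : Set Ω) : ℝ :=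
  ∑ ω, E.indicator P ω

/-- The tensor product `M₁ ⊗ ⋯ ⊗ Mₙ` of operators on `ℂ^β`. -/
def piTensor {β : Type*} {n : ℕ} (M : Fin n → Matrix β β ℂ) :
    Matrix (Fin n → β) (Fin n → β) ℂ :=
  Matrix.of fun x y => ∏ i, M i (x i) (y i)

/-- The operator sending `φ₁ ⊗ ⋯ ⊗ φₙ` to `φ_{π 1} ⊗ ⋯ ⊗ φ_{π n}`: the basis vector of `x` goes to
the basis vector of `x ∘ π`. -/
def permOp (β : Type*) [DecidableEq β] {n : ℕ} (π : Equiv.Perm (Fin n)) :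
    Matrix (Fin n → β) (Fin n → β) ℂ :=
  Matrix.of fun y x => if y = x ∘ π then 1 else 0

/-- Partial trace over the second factor. -/
def ptraceRight {ι κ : Type*} [Fintype κ] (W : Matrix (ι × κ) (ι × κ) ℂ) : Matrix ι ι ℂ :=
  Matrix.of fun i j => ∑ k, W (i, k) (j, k)

/-- Partial trace over the first factor. -/
def ptraceLeft {ι κ : Type*} [Fintype ι] (W : Matrix (ι × κ) (ι × κ) ℂ) : Matrix κ κ ℂ :=
  Matrix.of fun k l => ∑ i, W (i, k) (i, l)

/-- The identification of `A ⊗ H^{⊗ (n+r)}` with `(A ⊗ H^{⊗ n}) ⊗ H^{⊗ r}`. -/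
def splitLast {α β : Type*} {n r : ℕ}
    (W : Matrix (α × (Fin (n + r) → β)) (α × (Fin (n + r) → β)) ℂ) :
    Matrix ((α × (Fin n → β)) × (Fin r → β)) ((α × (Fin n → β)) × (Fin r → β)) ℂ :=
  W.submatrix (fun p => (p.1.1, Fin.append p.1.2 p.2)) (fun p => (p.1.1, Fin.append p.1.2 p.2))

/-- The partial state on the `j`-th of the `n` copies of `H`, all other systems traced out. -/
def singleSystem {α β : Type*} [Fintype α] [Fintype β] {n : ℕ} (j : Fin n)
    (W : Matrix (α × (Fin n → β)) (α × (Fin n → β)) ℂ) : Matrix β β ℂ :=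
  ptraceRight (W.submatrix
    (fun p : β × (α × ({i // i ≠ j} → β)) =>
      (p.2.1, (Equiv.funSplitAt j β).symm (p.1, p.2.2)))
    (fun p => (p.2.1, (Equiv.funSplitAt j β).symm (p.1, p.2.2))))

/-- The probability `tr (F ρ)` of the measurement outcome with operator `F`. -/
noncomputable def outcomeProb {ι : Type*} [Fintype ι] (F ρ : Matrix ι ι ℂ) : ℝ :=
  (F * ρ).trace.re

/-- The state on the first factor conditioned on the outcome with operator `F` of a measurement of
the second factor. -/
noncomputable def condState {ι κ : Type*} [Fintype ι] [DecidableEq ι] [Fintype κ]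
    (ρ : Matrix (ι × κ) (ι × κ) ℂ) (F : Matrix κ κ ℂ) : Matrix ι ι ℂ :=
  (((1 : Matrix ι ι ℂ) ⊗ₖ F) * ρ).trace⁻¹ • ptraceRight (((1 : Matrix ι ι ℂ) ⊗ₖ F) * ρ)

/-- An operator on `A ⊗ H^{⊗ n}` that is symmetric relative to `A`. -/
def IsSymmetricRel {α β : Type*} [Fintype α] [DecidableEq α] [Fintype β] [DecidableEq β] {n : ℕ}
    (ρ : Matrix (α × (Fin n → β)) (α × (Fin n → β)) ℂ) : Prop :=
  ∀ π : Equiv.Perm (Fin n),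
    ρ = ((1 : Matrix α α ℂ) ⊗ₖ permOp β π) * ρ * ((1 : Matrix α α ℂ) ⊗ₖ (permOp β π)ᴴ)

/-- A symmetric operator on `A ⊗ H^{⊗ n}` is `m`-exchangeable relative to `A`, for `m = n + r ≥ n`,
if it is the partial trace of a density operator on `A ⊗ H^{⊗ m}` that is symmetric relative
to `A`. -/
def IsExchangeableRel {α β : Type*} [Fintype α] [DecidableEq α] [Fintype β] [DecidableEq β] {n : ℕ}
    (m : ℕ) (ρ : Matrix (α × (Fin n → β)) (α × (Fin n → β)) ℂ) : Prop :=
  IsSymmetricRel ρ ∧ ∃ r : ℕ, n + r = m ∧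
    ∃ σ : Matrix (α × (Fin (n + r) → β)) (α × (Fin (n + r) → β)) ℂ,
      IsDensity σ ∧ IsSymmetricRel σ ∧ ρ = ptraceRight (splitLast σ)

/-- `F` is a dual of the family `G` in the real Hilbert space of hermitian operators with inner
product `tr (U V)`. -/
def IsDualOf {ζ ι : Type*} [Fintype ζ] [Fintype ι] (F G : ζ → Matrix ι ι ℂ) : Prop :=
  ∀ U : Matrix ι ι ℂ, U.IsHermitian → U = ∑ z, (F z * U).trace • G z

/-- `C₁(Z)`: the least value of `2 ∑ z, tr |G z|` over the hermitian families `G` such that `Z` is a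
dual of `G`, and `∞` if there is none. -/
noncomputable def POVM.C1 {ζ ι : Type*} [Fintype ζ] [Fintype ι] [DecidableEq ι]
    (Z : POVM ζ ι) : ℝ≥0∞ :=
  ⨅ (G : ζ → Matrix ι ι ℂ) (_ : ∀ z, (G z).IsHermitian) (_ : IsDualOf Z.op G),
    ENNReal.ofReal (2 * ∑ z, traceNorm (G z))

/-- `C₂(Z) = √|ζ| · C₁(Z)`. -/
noncomputable def POVM.C2 {ζ ι : Type*} [Fintype ζ] [Fintype ι] [DecidableEq ι]
    (Z : POVM ζ ι) : ℝ≥0∞ :=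
  ENNReal.ofReal (Real.sqrt (Fintype.card ζ)) * Z.C1

/-- The distribution of the outcomes when `Z` is applied to each of the last `k` copies of `H`. -/
noncomputable def POVM.outcomeDist {α β ζ : Type*} [Fintype α] [Fintype β] [DecidableEq β]
    [Fintype ζ] (Z : POVM ζ β) {n k : ℕ}
    (ρ : Matrix (α × (Fin (n + k) → β)) (α × (Fin (n + k) → β)) ℂ) (zbar : Fin k → ζ) : ℝ :=
  outcomeProb (piTensor fun i => Z.op (zbar i)) (ptraceLeft (splitLast ρ))

/-- The state on `A ⊗ H^{⊗ n}` conditioned on the outcomes `zbar` of the measurement `Z` on each of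
the last `k` copies of `H`. -/
noncomputable def POVM.condOn {α β ζ : Type*} [Fintype α] [DecidableEq α] [Fintype β]
    [DecidableEq β] [Fintype ζ] (Z : POVM ζ β) {n k : ℕ}
    (ρ : Matrix (α × (Fin (n + k) → β)) (α × (Fin (n + k) → β)) ℂ) (zbar : Fin k → ζ) :
    Matrix (α × (Fin n → β)) (α × (Fin n → β)) ℂ :=
  condState (splitLast ρ) (piTensor fun i => Z.op (zbar i))

/-! Let `σ` be the symmetric extension of `ρ` and `k = r + 1`. Besides the `k` measured copies, with
outcomes `x`, there are `r` extra copies; measure these and one of the `n` kept copies too, and call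
the outcomes `v`, again a `k`-tuple. Symmetry of `σ` makes the joint law of `(x, v)` invariant under
exchanging `x l` with `v l`. The difference of the two frequency vectors is then a sum with randomly
signed terms, so a sub-Gaussian estimate bounds the probability of those `x` for which the
conditional mean distance between `freq x` and `freq v` is at least `√(t/k) ε`
(`sum_mul_exp_norm_sum_entryDiff_le`, `sum_indicator_mean_varDist_ge_le`).

For every other `x` of positive probability, let `s` be the conditional state of one copy. Its
outcome probabilities are the conditional mean of `freq v`, so convexity gives the second claim. For
the first, exchangeability of a kept copy with the extra ones lets the operator `F_z` on that copy
be replaced by the frequency of `z` in `v` (`sum_freq_cons_smul`). This frequency is nearly the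
constant `tr (F_z s)`, so all outcome statistics of the copy nearly decouple from the other systems.
The dual family turns statistics back into operators, at the price `∑ tr |G_z|`
(`traceNorm_sub_kronecker_le`), and splitting off the `n` copies one by one gives the factor `n`
(`traceNorm_sub_kronecker_piTensor_le`). -/

/-! ### The trace norm of Hermitian matrices. -/

section TraceNorm

variable {ι κ : Type*}

theorem Matrix.isHermitian_finset_sum {s : Type*} (S : Finset s) {U : s → Matrix ι ι ℂ}
    (hU : ∀ i ∈ S, (U i).IsHermitian) : (∑ i ∈ S, U i).IsHermitian :=
  (selfAdjoint (Matrix ι ι ℂ)).sum_mem hU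

theorem Matrix.IsHermitian.real_smul {U : Matrix ι ι ℂ} (hU : U.IsHermitian) (c : ℝ) :
    (c • U).IsHermitian := by
  rw [Matrix.IsHermitian, Matrix.conjTranspose_smul, hU.eq, star_trivial]

theorem Matrix.IsHermitian.kron {U : Matrix ι ι ℂ} {V : Matrix κ κ ℂ} (hU : U.IsHermitian)
    (hV : V.IsHermitian) : (U ⊗ₖ V).IsHermitian := by
  rw [Matrix.IsHermitian, Matrix.conjTranspose_kronecker, hU.eq, hV.eq]

theorem Matrix.PosSemidef.real_smul {P : Matrix ι ι ℂ} (hP : P.PosSemidef) {c : ℝ} (hc : 0 ≤ c) :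
    (c • P).PosSemidef := by
  have : c • P = (c : ℂ) • P := by ext; simp
  rw [this]
  exact hP.smul (by exact_mod_cast hc)

variable [Fintype ι]

theorem Matrix.PosSemidef.trace_re_nonneg {P : Matrix ι ι ℂ} (hP : P.PosSemidef) :
    0 ≤ P.trace.re :=
  (Complex.le_def.1 hP.trace_nonneg).1

theorem Matrix.PosSemidef.trace_eq_re {P : Matrix ι ι ℂ} (hP : P.PosSemidef) :
    P.trace = (P.trace.re : ℂ) :=
  Complex.ext rfl (by simpa using (Complex.le_def.1 hP.trace_nonneg).2.symm)

variable [DecidableEq ι] [Fintype κ] [DecidableEq κ]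

/-- The Jordan decomposition is optimal by `traceNorm_sub_le`. The triangle inequality and the bound
for tensor products follow by combining decompositions. -/
theorem exists_posSemidef_sub_eq {U : Matrix ι ι ℂ} (hU : U.IsHermitian) :
    ∃ P N : Matrix ι ι ℂ, P.PosSemidef ∧ N.PosSemidef ∧ U = P - N ∧
      P.trace.re + N.trace.re = traceNorm U := by
  have hsa : IsSelfAdjoint U := hU
  refine ⟨U⁺, U⁻, Matrix.nonneg_iff_posSemidef.1 (CFC.posPart_nonneg U),
    Matrix.nonneg_iff_posSemidef.1 (CFC.negPart_nonneg U),
    (CFC.posPart_sub_negPart U hsa).symm, ?_⟩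
  rw [traceNorm, ← CFC.posPart_add_negPart U hsa, Matrix.trace_add, Complex.add_re]

theorem traceNorm_eq_sum_abs_eigenvalues {U : Matrix ι ι ℂ} (hU : U.IsHermitian) :
    traceNorm U = ∑ i, |hU.eigenvalues i| := by
  have hsa : IsSelfAdjoint U := hU
  rw [traceNorm, CFC.abs_eq_cfc_norm U hsa, hU.cfc_eq, Matrix.IsHermitian.cfc,
    Unitary.conjStarAlgAut_apply, Matrix.trace_mul_comm, ← mul_assoc,
    Unitary.coe_star_mul_self, one_mul, Matrix.trace_diagonal]
  simp

/-- In an eigenbasis of `P - N` each eigenvalue is a difference of nonnegative diagonal entries of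
`P` and `N`, hence bounded in absolute value by their sum. -/
theorem traceNorm_sub_le {P N : Matrix ι ι ℂ} (hP : P.PosSemidef) (hN : N.PosSemidef) :
    traceNorm (P - N) ≤ P.trace.re + N.trace.re := by
  have hU : (P - N).IsHermitian := hP.1.sub hN.1
  set V : Matrix ι ι ℂ := (hU.eigenvectorUnitary : Matrix ι ι ℂ)
  have hVV : V * Vᴴ = 1 := Unitary.coe_mul_star_self hU.eigenvectorUnitary
  have hdiag : Vᴴ * (P - N) * V = Matrix.diagonal (RCLike.ofReal ∘ hU.eigenvalues) := by
    have h := hU.conjStarAlgAut_star_eigenvectorUnitary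
    rw [Unitary.conjStarAlgAut_apply] at h
    simp only [Unitary.coe_star, star_star] at h
    exact h
  have htr : ∀ W : Matrix ι ι ℂ, (Vᴴ * W * V).trace = W.trace := fun W => by
    rw [Matrix.trace_mul_comm, ← mul_assoc, hVV, one_mul]
  have hP' : (Vᴴ * P * V).PosSemidef := hP.conjTranspose_mul_mul_same V
  have hN' : (Vᴴ * N * V).PosSemidef := hN.conjTranspose_mul_mul_same V
  rw [traceNorm_eq_sum_abs_eigenvalues hU, ← htr P, ← htr N, Matrix.trace, Matrix.trace,
    Complex.re_sum, Complex.re_sum, ← Finset.sum_add_distrib]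
  refine Finset.sum_le_sum fun i _ => ?_
  have hi : hU.eigenvalues i = ((Vᴴ * P * V) i i).re - ((Vᴴ * N * V) i i).re := by
    have h := congrFun (congrFun hdiag i) i
    rw [mul_sub, sub_mul, Matrix.sub_apply, Matrix.diagonal_apply_eq] at h
    have := congrArg Complex.re h
    simpa using this.symm
  have h1 : 0 ≤ ((Vᴴ * P * V) i i).re := (Complex.le_def.1 (hP'.diag_nonneg (i := i))).1
  have h2 : 0 ≤ ((Vᴴ * N * V) i i).re := (Complex.le_def.1 (hN'.diag_nonneg (i := i))).1
  rw [hi, Matrix.diag_apply, Matrix.diag_apply, abs_le]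
  constructor <;> linarith

theorem traceNorm_nonneg (U : Matrix ι ι ℂ) : 0 ≤ traceNorm U :=
  (Matrix.nonneg_iff_posSemidef.1 (CFC.abs_nonneg U)).trace_re_nonneg

theorem traceNorm_of_posSemidef {P : Matrix ι ι ℂ} (hP : P.PosSemidef) :
    traceNorm P = P.trace.re := by
  rw [traceNorm, CFC.abs_of_nonneg P (Matrix.nonneg_iff_posSemidef.2 hP)]

theorem traceNorm_zero : traceNorm (0 : Matrix ι ι ℂ) = 0 := by simp [traceNorm]

theorem abs_trace_re_le_traceNorm {U : Matrix ι ι ℂ} (hU : U.IsHermitian) :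
    |U.trace.re| ≤ traceNorm U := by
  obtain ⟨P, N, hP, hN, hd, ht⟩ := exists_posSemidef_sub_eq hU
  have h1 := hP.trace_re_nonneg
  have h2 := hN.trace_re_nonneg
  rw [← ht, hd, Matrix.trace_sub, Complex.sub_re, abs_le]
  constructor <;> linarith

theorem traceNorm_add_le {U V : Matrix ι ι ℂ} (hU : U.IsHermitian) (hV : V.IsHermitian) :
    traceNorm (U + V) ≤ traceNorm U + traceNorm V := by
  obtain ⟨P, N, hP, hN, hd, ht⟩ := exists_posSemidef_sub_eq hU
  obtain ⟨P', N', hP', hN', hd', ht'⟩ := exists_posSemidef_sub_eq hV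
  rw [← ht, ← ht', show U + V = (P + P') - (N + N') by rw [hd, hd']; abel]
  refine (traceNorm_sub_le (hP.add hP') (hN.add hN')).trans (le_of_eq ?_)
  simp only [Matrix.trace_add, Complex.add_re]
  ring

theorem traceNorm_sum_le {s : Type*} (S : Finset s) {U : s → Matrix ι ι ℂ}
    (hU : ∀ i ∈ S, (U i).IsHermitian) : traceNorm (∑ i ∈ S, U i) ≤ ∑ i ∈ S, traceNorm (U i) := by
  classical
  induction S using Finset.induction_on with
  | empty => simp [traceNorm_zero]
  | insert a S ha ih =>
    rw [Finset.sum_insert ha, Finset.sum_insert ha]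
    have h := fun i hi => hU i (Finset.mem_insert_of_mem hi)
    exact (traceNorm_add_le (hU a (Finset.mem_insert_self a S))
      (Matrix.isHermitian_finset_sum S h)).trans (by gcongr; exact ih h)

theorem traceNorm_real_smul_posSemidef {P : Matrix ι ι ℂ} (hP : P.PosSemidef) (c : ℝ) :
    traceNorm (c • P) ≤ |c| * P.trace.re := by
  rcases le_total 0 c with hc | hc
  · rw [traceNorm_of_posSemidef (hP.real_smul hc), abs_of_nonneg hc, Matrix.trace_smul]
    simp
  · have h := traceNorm_sub_le (Matrix.PosSemidef.zero (n := ι) (R := ℂ))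
      (hP.real_smul (neg_nonneg.2 hc))
    rw [neg_smul, sub_neg_eq_add, zero_add] at h
    rw [abs_of_nonpos hc]
    simpa using h

theorem traceNorm_kronecker_le {U : Matrix ι ι ℂ} {V : Matrix κ κ ℂ} (hU : U.IsHermitian)
    (hV : V.IsHermitian) : traceNorm (U ⊗ₖ V) ≤ traceNorm U * traceNorm V := by
  obtain ⟨P, N, hP, hN, hd, ht⟩ := exists_posSemidef_sub_eq hU
  obtain ⟨P', N', hP', hN', hd', ht'⟩ := exists_posSemidef_sub_eq hV
  have h : U ⊗ₖ V = (P ⊗ₖ P' + N ⊗ₖ N') - (P ⊗ₖ N' + N ⊗ₖ P') := by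
    rw [hd, hd']
    ext i j
    simp only [Matrix.kroneckerMap_apply, Matrix.sub_apply, Matrix.add_apply]
    ring
  rw [h, ← ht, ← ht']
  refine (traceNorm_sub_le ((hP.kronecker hP').add (hN.kronecker hN'))
    ((hP.kronecker hN').add (hN.kronecker hP'))).trans (le_of_eq ?_)
  simp only [Matrix.trace_add, Matrix.trace_kronecker]
  rw [hP.trace_eq_re, hN.trace_eq_re, hP'.trace_eq_re, hN'.trace_eq_re]
  simp only [← Complex.ofReal_mul, ← Complex.ofReal_add, Complex.ofReal_re]
  ring

theorem traceNorm_submatrix_le {U : Matrix ι ι ℂ} (hU : U.IsHermitian) (e : κ ≃ ι) :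
    traceNorm (U.submatrix e e) ≤ traceNorm U := by
  obtain ⟨P, N, hP, hN, hd, ht⟩ := exists_posSemidef_sub_eq hU
  have htr : ∀ W : Matrix ι ι ℂ, (W.submatrix e e).trace = W.trace := fun W =>
    e.sum_comp fun i => W i i
  rw [← ht, hd, Matrix.submatrix_sub, ← htr P, ← htr N]
  exact traceNorm_sub_le (hP.submatrix e) (hN.submatrix e)

end TraceNorm

/-! ### Contracting a tensor factor with an operator. -/

section Contraction

variable {ι κ : Type*}

/-- The partial trace of `(1 ⊗ F) * W` over the second factor. -/
def partialContract [Fintype κ] (W : Matrix (ι × κ) (ι × κ) ℂ) (F : Matrix κ κ ℂ) :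
    Matrix ι ι ℂ :=
  Matrix.of fun i j => ∑ k, ∑ l, F k l * W (i, l) (j, k)

theorem partialContract_apply [Fintype κ] (W : Matrix (ι × κ) (ι × κ) ℂ) (F : Matrix κ κ ℂ)
    (i j : ι) : partialContract W F i j = ∑ k, ∑ l, F k l * W (i, l) (j, k) := rfl

theorem partialContract_one [Fintype κ] [DecidableEq κ] (W : Matrix (ι × κ) (ι × κ) ℂ) :
    partialContract W 1 = ptraceRight W := by
  ext i j
  simp [partialContract_apply, ptraceRight, Matrix.one_apply]

theorem partialContract_single [Fintype κ] [DecidableEq κ] (W : Matrix (ι × κ) (ι × κ) ℂ)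
    (a b : κ) (i j : ι) :
    partialContract W (Matrix.single b a 1) i j = W (i, a) (j, b) := by
  rw [partialContract_apply, Finset.sum_eq_single b, Finset.sum_eq_single a]
  · simp
  · intro l _ hl
    simp [hl.symm]
  · simp
  · intro l _ hl
    simp [hl.symm]
  · simp

theorem partialContract_sum_right [Fintype κ] {s : Type*} (S : Finset s)
    (W : Matrix (ι × κ) (ι × κ) ℂ) (F : s → Matrix κ κ ℂ) :
    partialContract W (∑ u ∈ S, F u) = ∑ u ∈ S, partialContract W (F u) := by
  ext i j
  simp only [partialContract_apply, Matrix.sum_apply, Finset.sum_mul]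
  rw [Finset.sum_comm]
  simp_rw [Finset.sum_comm (s := Finset.univ) (t := S)]
  exact Finset.sum_congr rfl fun u _ => Finset.sum_comm

theorem partialContract_sum_left [Fintype κ] {s : Type*} (S : Finset s)
    (W : s → Matrix (ι × κ) (ι × κ) ℂ) (F : Matrix κ κ ℂ) :
    partialContract (∑ u ∈ S, W u) F = ∑ u ∈ S, partialContract (W u) F := by
  ext i j
  simp only [partialContract_apply, Matrix.sum_apply, Finset.mul_sum]
  simp_rw [Finset.sum_comm (s := Finset.univ) (t := S)]

theorem partialContract_smul_left [Fintype κ] (c : ℝ)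
    (W : Matrix (ι × κ) (ι × κ) ℂ) (F : Matrix κ κ ℂ) :
    partialContract (c • W) F = c • partialContract W F := by
  ext i j
  simp only [partialContract_apply, Matrix.smul_apply, Finset.smul_sum, Complex.real_smul]
  refine Finset.sum_congr rfl fun k _ => Finset.sum_congr rfl fun l _ => by ring

variable [Fintype ι] [Fintype κ]

theorem one_kronecker_mul_apply [DecidableEq ι] (W : Matrix (ι × κ) (ι × κ) ℂ) (F : Matrix κ κ ℂ)
    (p q : ι × κ) : (((1 : Matrix ι ι ℂ) ⊗ₖ F) * W) p q = ∑ l, F p.2 l * W (p.1, l) q := by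
  rw [Matrix.mul_apply, Fintype.sum_prod_type, Finset.sum_eq_single p.1]
  · simp [Matrix.kroneckerMap_apply]
  · intro i _ hi
    simp [Matrix.kroneckerMap_apply, hi.symm]
  · simp

theorem mul_one_kronecker_apply [DecidableEq ι] (W : Matrix (ι × κ) (ι × κ) ℂ) (F : Matrix κ κ ℂ)
    (p q : ι × κ) : (W * ((1 : Matrix ι ι ℂ) ⊗ₖ F)) p q = ∑ l, W p (q.1, l) * F l q.2 := by
  rw [Matrix.mul_apply, Fintype.sum_prod_type, Finset.sum_eq_single q.1]
  · simp [Matrix.kroneckerMap_apply]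
  · intro i _ hi
    simp [Matrix.kroneckerMap_apply, hi]
  · simp

theorem partialContract_eq_ptraceRight [DecidableEq ι] (W : Matrix (ι × κ) (ι × κ) ℂ)
    (F : Matrix κ κ ℂ) :
    partialContract W F = ptraceRight (((1 : Matrix ι ι ℂ) ⊗ₖ F) * W) := by
  ext i j
  simp [partialContract_apply, ptraceRight, one_kronecker_mul_apply]

theorem trace_ptraceRight (W : Matrix (ι × κ) (ι × κ) ℂ) : (ptraceRight W).trace = W.trace := by
  simp [Matrix.trace, ptraceRight, Fintype.sum_prod_type]

theorem condState_eq [DecidableEq ι] (W : Matrix (ι × κ) (ι × κ) ℂ) (F : Matrix κ κ ℂ) :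
    condState W F = (partialContract W F).trace⁻¹ • partialContract W F := by
  rw [condState, partialContract_eq_ptraceRight, trace_ptraceRight]

theorem outcomeProb_ptraceLeft (W : Matrix (ι × κ) (ι × κ) ℂ) (F : Matrix κ κ ℂ) :
    outcomeProb F (ptraceLeft W) = (partialContract W F).trace.re := by
  rw [outcomeProb]
  congr 1
  simp only [Matrix.trace, Matrix.diag_apply, Matrix.mul_apply, ptraceLeft, Matrix.of_apply,
    partialContract_apply, Finset.mul_sum]
  rw [Finset.sum_comm]
  refine (Finset.sum_congr rfl fun l _ => Finset.sum_comm).trans ?_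
  rw [Finset.sum_comm]
  refine Finset.sum_congr rfl fun i _ => Finset.sum_comm

omit [Fintype ι] in
theorem posSemidef_ptraceRight {W : Matrix (ι × κ) (ι × κ) ℂ} (hW : W.PosSemidef) :
    (ptraceRight W).PosSemidef := by
  have h : ptraceRight W = ∑ k, W.submatrix (fun i => (i, k)) (fun i => (i, k)) := by
    ext i j
    simp [ptraceRight, Matrix.sum_apply]
  rw [h]
  exact Matrix.posSemidef_sum _ fun k _ => hW.submatrix _

/-- Writing `F = Bᴴ * B` and moving one factor cyclically inside the partial trace gives the partial
trace of a congruence of `W`. -/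
theorem posSemidef_partialContract [DecidableEq ι] [DecidableEq κ] {W : Matrix (ι × κ) (ι × κ) ℂ}
    (hW : W.PosSemidef) {F : Matrix κ κ ℂ} (hF : F.PosSemidef) :
    (partialContract W F).PosSemidef := by
  obtain ⟨B, rfl⟩ := CStarAlgebra.nonneg_iff_eq_star_mul_self.mp hF.nonneg
  rw [Matrix.star_eq_conjTranspose]
  have h : partialContract W (Bᴴ * B) = ptraceRight
      (((1 : Matrix ι ι ℂ) ⊗ₖ B) * W * ((1 : Matrix ι ι ℂ) ⊗ₖ B)ᴴ) := by
    ext i j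
    rw [Matrix.conjTranspose_kronecker, Matrix.conjTranspose_one]
    simp only [partialContract_apply, ptraceRight, Matrix.of_apply, mul_one_kronecker_apply,
      one_kronecker_mul_apply]
    simp only [Matrix.mul_apply, Finset.sum_mul]
    rw [Finset.sum_comm (s := Finset.univ) (t := Finset.univ)
      (f := fun k l => ∑ m, B k m * W (i, m) (j, l) * Bᴴ l k)]
    refine Finset.sum_congr rfl fun k _ => Finset.sum_comm.trans ?_
    exact Finset.sum_congr rfl fun m _ => Finset.sum_congr rfl fun l _ => by ring
  rw [h]
  exact posSemidef_ptraceRight (hW.mul_mul_conjTranspose_same _)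

end Contraction

/-! ### Contractions with product operators on tensor powers. -/

section Slice

variable {α β : Type*}

theorem piTensor_apply {n : ℕ} (M : Fin n → Matrix β β ℂ) (x y : Fin n → β) :
    piTensor M x y = ∏ i, M i (x i) (y i) := rfl

theorem piTensor_one [DecidableEq β] {n : ℕ} :
    piTensor (fun _ : Fin n => (1 : Matrix β β ℂ)) = 1 := by
  ext x y
  simp only [piTensor_apply, Matrix.one_apply, Finset.prod_ite_zero, funext_iff]
  simp

theorem sum_piTensor {ζ : Type*} [Fintype ζ] [DecidableEq ζ] {n : ℕ}
    (F : ζ → Matrix β β ℂ) :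
    ∑ w : Fin n → ζ, piTensor (fun i => F (w i)) = piTensor fun _ => ∑ z, F z := by
  ext x y
  simp only [Matrix.sum_apply, piTensor_apply]
  rw [Finset.prod_univ_sum]
  simp

theorem piTensor_conjTranspose_mul [Fintype β] [DecidableEq β] {n : ℕ} (M N : Fin n → Matrix β β ℂ) :
    (piTensor M)ᴴ * piTensor N = piTensor fun i => (M i)ᴴ * N i := by
  ext x y
  simp only [Matrix.mul_apply, piTensor_apply, Matrix.conjTranspose_apply, star_prod,
    ← Finset.prod_mul_distrib]
  rw [Finset.prod_univ_sum]
  simp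

theorem posSemidef_piTensor [Fintype β] [DecidableEq β] {n : ℕ} {M : Fin n → Matrix β β ℂ}
    (hM : ∀ i, (M i).PosSemidef) : (piTensor M).PosSemidef := by
  choose B hB using fun i => CStarAlgebra.nonneg_iff_eq_star_mul_self.mp (hM i).nonneg
  rw [show M = fun i => (B i)ᴴ * B i from funext hB, ← piTensor_conjTranspose_mul]
  exact Matrix.posSemidef_conjTranspose_mul_self _

/-- The identification of `A ⊗ H^{⊗ (n+1)}` with `(A ⊗ H^{⊗ n}) ⊗ H`. -/
def splitSnoc {n : ℕ} (W : Matrix (α × (Fin (n + 1) → β)) (α × (Fin (n + 1) → β)) ℂ) :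
    Matrix ((α × (Fin n → β)) × β) ((α × (Fin n → β)) × β) ℂ :=
  W.submatrix (fun p => (p.1.1, Fin.snoc p.1.2 p.2)) (fun p => (p.1.1, Fin.snoc p.1.2 p.2))

theorem partialContract_snoc [Fintype β] {n : ℕ}
    (W : Matrix (α × (Fin (n + 1) → β)) (α × (Fin (n + 1) → β)) ℂ)
    (M : Fin n → Matrix β β ℂ) (X : Matrix β β ℂ) :
    partialContract W (piTensor (Fin.snoc M X : Fin (n + 1) → Matrix β β ℂ)) =
      partialContract (partialContract (splitSnoc W) X) (piTensor M) := by
  ext a a'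
  simp only [partialContract_apply, splitSnoc, Matrix.submatrix_apply, piTensor_apply]
  rw [← (Fin.snocEquiv fun _ => β).sum_comp, Fintype.sum_prod_type, Finset.sum_comm]
  refine Finset.sum_congr rfl fun b _ => ?_
  simp_rw [← (Fin.snocEquiv fun _ => β).sum_comp, Fintype.sum_prod_type]
  refine (Finset.sum_congr rfl fun x _ => Finset.sum_comm).trans ?_
  rw [Finset.sum_comm]
  refine Finset.sum_congr rfl fun b' _ => ?_
  rw [Finset.mul_sum]
  refine Finset.sum_congr rfl fun x _ => ?_
  rw [Finset.mul_sum]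
  refine Finset.sum_congr rfl fun y _ => ?_
  simp [Fin.snocEquiv, Fin.prod_univ_castSucc, mul_assoc]

/-- Products of matrix units recover every entry, so an identity tested on all product operators is
an identity of matrices. -/
theorem partialContract_single_piTensor [Fintype β] [DecidableEq β] {n : ℕ}
    (W : Matrix (α × (Fin n → β)) (α × (Fin n → β)) ℂ) (x y : Fin n → β) (a a' : α) :
    partialContract W (piTensor fun i => Matrix.single (y i) (x i) 1) a a' = W (a, x) (a', y) := by
  rw [← partialContract_single W x y a a']
  congr 2
  ext x' y'
  simp only [piTensor_apply, Matrix.single_apply, Finset.prod_ite_zero, funext_iff]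
  simp [forall_and]

theorem partialContract_append [Fintype β] {n r : ℕ}
    (W : Matrix (α × (Fin (n + r) → β)) (α × (Fin (n + r) → β)) ℂ)
    (M : Fin n → Matrix β β ℂ) (N : Fin r → Matrix β β ℂ) :
    partialContract W (piTensor (Fin.append M N)) =
      partialContract (partialContract (splitLast W) (piTensor N)) (piTensor M) := by
  ext a a'
  simp only [partialContract_apply, splitLast, Matrix.submatrix_apply, piTensor_apply]
  rw [← (Fin.appendEquiv n r).sum_comp, Fintype.sum_prod_type]
  refine Finset.sum_congr rfl fun b _ => ?_
  simp_rw [← (Fin.appendEquiv n r).sum_comp, Fintype.sum_prod_type]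
  rw [Finset.sum_comm]
  refine Finset.sum_congr rfl fun b' _ => ?_
  rw [Finset.mul_sum]
  refine Finset.sum_congr rfl fun x _ => ?_
  rw [Finset.mul_sum]
  refine Finset.sum_congr rfl fun y _ => ?_
  simp [Fin.appendEquiv, Fin.prod_univ_add, mul_assoc]

theorem IsSymmetricRel.apply_comp [Fintype α] [DecidableEq α] [Fintype β] [DecidableEq β] {n : ℕ}
    {W : Matrix (α × (Fin n → β)) (α × (Fin n → β)) ℂ} (hW : IsSymmetricRel W)
    (π : Equiv.Perm (Fin n)) (a a' : α) (x y : Fin n → β) :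
    W (a, x ∘ π) (a', y ∘ π) = W (a, x) (a', y) := by
  conv_lhs => rw [hW π]
  rw [mul_assoc, one_kronecker_mul_apply, Finset.sum_eq_single x]
  · rw [mul_one_kronecker_apply, Finset.sum_eq_single y]
    · simp [permOp]
    · intro z _ hz
      simp [permOp, π.surjective.injective_comp_right.eq_iff, hz.symm]
    · simp
  · intro z _ hz
    simp [permOp, π.surjective.injective_comp_right.eq_iff, hz.symm]
  · simp

theorem partialContract_piTensor_comp [Fintype α] [DecidableEq α] [Fintype β] [DecidableEq β] {n : ℕ}
    {W : Matrix (α × (Fin n → β)) (α × (Fin n → β)) ℂ} (hW : IsSymmetricRel W)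
    (π : Equiv.Perm (Fin n)) (M : Fin n → Matrix β β ℂ) :
    partialContract W (piTensor (M ∘ π)) = partialContract W (piTensor M) := by
  ext a a'
  simp only [partialContract_apply, piTensor_apply]
  let e : (Fin n → β) ≃ (Fin n → β) := π.symm.arrowCongr (Equiv.refl β)
  have he : ∀ x, e x = x ∘ π := fun x => rfl
  rw [← e.sum_comp]
  refine Finset.sum_congr rfl fun x _ => ?_
  rw [← e.sum_comp]
  refine Finset.sum_congr rfl fun y _ => ?_
  rw [he, he, hW.apply_comp]
  congr 1
  exact Equiv.prod_comp π fun i => M i (x i) (y i)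

/-- Expresses the one-copy marginal through contractions, where the exchange symmetries are
available. -/
theorem trace_mul_singleSystem [Fintype α] [Fintype β] [DecidableEq β] {n : ℕ} (j : Fin n)
    (W : Matrix (α × (Fin n → β)) (α × (Fin n → β)) ℂ) (F : Matrix β β ℂ) :
    (F * singleSystem j W).trace = (partialContract W (piTensor (Function.update 1 j F))).trace := by
  simp only [Matrix.trace, Matrix.diag_apply, Matrix.mul_apply, singleSystem, ptraceRight,
    Matrix.of_apply, Matrix.submatrix_apply, partialContract_apply, Fintype.sum_prod_type,
    piTensor_apply]
  simp_rw [← (Equiv.funSplitAt j β).symm.sum_comp, Fintype.sum_prod_type]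
  have hprod : ∀ (b b' : β) (x y : {i // i ≠ j} → β),
      ∏ i, (Function.update 1 j F : Fin n → Matrix β β ℂ) i ((Equiv.funSplitAt j β).symm (b, x) i)
        ((Equiv.funSplitAt j β).symm (b', y) i) = F b b' * if x = y then 1 else 0 := by
    intro b b' x y
    rw [Fintype.prod_eq_mul_prod_subtype_ne _ j]
    congr 1
    · simp [Equiv.funSplitAt, Equiv.piSplitAt]
    · have hi : ∀ i : {i // i ≠ j},
          (Function.update 1 j F : Fin n → Matrix β β ℂ) i ((Equiv.funSplitAt j β).symm (b, x) i)
            ((Equiv.funSplitAt j β).symm (b', y) i) = if x i = y i then 1 else 0 := fun i => by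
        rw [Function.update_of_ne i.2]
        simp [Equiv.funSplitAt, Equiv.piSplitAt, Matrix.one_apply, i.2]
      simp only [hi, Finset.prod_ite_zero, funext_iff, Finset.mem_univ, true_imp_iff,
        Finset.prod_const_one]
  simp_rw [hprod]
  simp only [mul_ite, mul_one, mul_zero, ite_mul, zero_mul, Finset.sum_ite_eq, Finset.mem_univ,
    if_true, Finset.mul_sum]
  rw [Finset.sum_comm (s := Finset.univ (α := α))]
  refine Finset.sum_congr rfl fun b _ => Finset.sum_comm.trans ?_
  exact Finset.sum_congr rfl fun a _ => Finset.sum_comm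

theorem posSemidef_singleSystem [Fintype α] [Fintype β] {n : ℕ} (j : Fin n)
    {W : Matrix (α × (Fin n → β)) (α × (Fin n → β)) ℂ} (hW : W.PosSemidef) :
    (singleSystem j W).PosSemidef :=
  posSemidef_ptraceRight (hW.submatrix _)

end Slice

/-! ### Reconstruction from a dual family. -/

section Dual

variable {ι κ ζ : Type*} [Fintype κ] [Fintype ζ]

/-- Complex linearity extends the expansion beyond Hermitian operators; this is needed because the
blocks of a Hermitian matrix need not be Hermitian. -/
theorem IsDualOf.eq_sum {F G : ζ → Matrix κ κ ℂ} (h : IsDualOf F G) (U : Matrix κ κ ℂ) :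
    U = ∑ z, (F z * U).trace • G z := by
  have h1 := h (realPart U : Matrix κ κ ℂ) (realPart U).2
  have h2 := h (imaginaryPart U : Matrix κ κ ℂ) (imaginaryPart U).2
  conv_lhs => rw [← realPart_add_I_smul_imaginaryPart U, h1, h2]
  rw [Finset.smul_sum, ← Finset.sum_add_distrib]
  refine Finset.sum_congr rfl fun z _ => ?_
  rw [smul_smul, ← add_smul]
  congr 1
  conv_rhs => rw [← realPart_add_I_smul_imaginaryPart U]
  rw [mul_add, Matrix.trace_add, mul_smul_comm, Matrix.trace_smul, smul_eq_mul]

theorem IsDualOf.eq_sum_kronecker {F G : ζ → Matrix κ κ ℂ} (h : IsDualOf F G)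
    (W : Matrix (ι × κ) (ι × κ) ℂ) : W = ∑ z, partialContract W (F z) ⊗ₖ G z := by
  ext ⟨i, b⟩ ⟨j, b'⟩
  have := congrFun (congrFun (h.eq_sum (Matrix.of fun b b' => W (i, b) (j, b'))) b) b'
  rw [Matrix.of_apply] at this
  rw [this, Matrix.sum_apply, Matrix.sum_apply]
  rfl

end Dual

/-! ### Outcome probabilities, and a lower bound for `C₁`. -/

section Outcome

variable {ι ζ : Type*} [Fintype ι] [DecidableEq ι] [Fintype ζ]

theorem trace_mul_nonneg_of_posSemidef {F s : Matrix ι ι ℂ} (hF : F.PosSemidef)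
    (hs : s.PosSemidef) : 0 ≤ (F * s).trace := by
  obtain ⟨B, rfl⟩ := CStarAlgebra.nonneg_iff_eq_star_mul_self.mp hF.nonneg
  rw [mul_assoc, Matrix.trace_mul_comm]
  exact (hs.mul_mul_conjTranspose_same B).trace_nonneg

theorem trace_mul_eq_outcomeProb {F s : Matrix ι ι ℂ} (hF : F.PosSemidef) (hs : s.PosSemidef) :
    (F * s).trace = (outcomeProb F s : ℂ) :=
  Complex.ext rfl (by
    simpa using (Complex.le_def.1 (trace_mul_nonneg_of_posSemidef hF hs)).2.symm)

theorem outcomeProb_nonneg {F s : Matrix ι ι ℂ} (hF : F.PosSemidef) (hs : s.PosSemidef) :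
    0 ≤ outcomeProb F s :=
  (Complex.le_def.1 (trace_mul_nonneg_of_posSemidef hF hs)).1

theorem POVM.sum_outcomeProb (Z : POVM ζ ι) {s : Matrix ι ι ℂ} (hs : IsDensity s) :
    ∑ z, outcomeProb (Z.op z) s = 1 := by
  simp only [outcomeProb]
  rw [← Complex.re_sum, ← Matrix.trace_sum, ← Finset.sum_mul, Z.sum_eq_one, one_mul, hs.2,
    Complex.one_re]

/-- Taking traces in the expansion of `s` gives `1 ≤ ∑ tr |G z|`. Only `C₁ ≠ 0` is needed later, to
keep the final inequality strict. -/
theorem POVM.one_le_C1 (Z : POVM ζ ι) {s : Matrix ι ι ℂ} (hs : IsDensity s) : 1 ≤ Z.C1 := by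
  refine le_iInf fun G => le_iInf fun hG => le_iInf fun hdual => ?_
  rw [← ENNReal.ofReal_one]
  refine ENNReal.ofReal_le_ofReal ?_
  have h1 := congrArg (fun U => U.trace.re) (hdual s hs.1.1)
  simp only [trace_mul_eq_outcomeProb (Z.posSemidef _) hs.1, hs.2, Complex.one_re,
    Matrix.trace_sum, Matrix.trace_smul, Complex.re_sum, smul_eq_mul, Complex.re_ofReal_mul] at h1
  have h2 : ∀ z, outcomeProb (Z.op z) s * (G z).trace.re ≤ traceNorm (G z) := fun z => by
    have h0 := outcomeProb_nonneg (Z.posSemidef z) hs.1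
    have h1 : outcomeProb (Z.op z) s ≤ 1 := by
      rw [← Z.sum_outcomeProb hs]
      exact Finset.single_le_sum (fun z _ => outcomeProb_nonneg (Z.posSemidef z) hs.1)
        (Finset.mem_univ z)
    calc _ ≤ outcomeProb (Z.op z) s * traceNorm (G z) :=
          mul_le_mul_of_nonneg_left ((le_abs_self _).trans (abs_trace_re_le_traceNorm (hG z))) h0
      _ ≤ 1 * traceNorm (G z) := mul_le_mul_of_nonneg_right h1 (traceNorm_nonneg _)
      _ = _ := one_mul _
  have h3 := Finset.sum_le_sum fun z (_ : z ∈ Finset.univ) => h2 z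
  linarith

end Outcome

/-! ### Splitting off one tensor factor. -/

section OneStep

variable {ι κ ζ Ω : Type*} [Fintype ι] [DecidableEq ι] [Fintype κ] [DecidableEq κ] [Fintype ζ]
  [Fintype Ω]

/-- If the outcome `z` on the second factor can be replaced by the statistic `f`, the distance of
a state from a product is bounded by the mean deviation of `f`. -/
theorem traceNorm_sub_kronecker_le (Z : POVM ζ κ) {G : ζ → Matrix κ κ ℂ}
    (hG : ∀ z, (G z).IsHermitian) (hdual : IsDualOf Z.op G)
    {τ : Ω → Matrix (ι × κ) (ι × κ) ℂ} (hτ : ∀ u, (τ u).PosSemidef) (f : Ω → ζ → ζ → ℝ)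
    (hf : ∀ z, ∑ u, partialContract (τ u) (Z.op z) =
      ∑ u, ∑ z', f u z' z • partialContract (τ u) (Z.op z'))
    {s : Matrix κ κ ℂ} (hs : s.PosSemidef) {c : ζ → ℝ}
    (hc : ∀ z, ∑ u, ∑ z', |f u z' z - outcomeProb (Z.op z) s| *
      (partialContract (τ u) (Z.op z')).trace.re ≤ c z) :
    traceNorm (∑ u, τ u - ptraceRight (∑ u, τ u) ⊗ₖ s) ≤ ∑ z, c z * traceNorm (G z) := by
  have hpos : ∀ u z, (partialContract (τ u) (Z.op z)).PosSemidef := fun u z =>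
    posSemidef_partialContract (hτ u) (Z.posSemidef z)
  -- `D z` is the failure of outcome `z` to be independent of the first factor. In this form it is a
  -- combination of positive operators whose coefficients are the deviations of `f`.
  set D : ζ → Matrix ι ι ℂ := fun z =>
    ∑ u, ∑ z', (f u z' z - outcomeProb (Z.op z) s) • partialContract (τ u) (Z.op z') with hD
  have hherm : ∀ (r : ℝ) u z, (r • partialContract (τ u) (Z.op z)).IsHermitian := fun r u z =>
    (hpos u z).1.real_smul r
  have hDherm : ∀ z, (D z).IsHermitian := fun z =>
    Matrix.isHermitian_finset_sum _ fun u _ => Matrix.isHermitian_finset_sum _ fun z' _ =>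
      hherm _ u z'
  have hDnorm : ∀ z, traceNorm (D z) ≤ c z := fun z => by
    refine le_trans ?_ (hc z)
    refine (traceNorm_sum_le _ fun u _ => Matrix.isHermitian_finset_sum _ fun z' _ =>
      hherm _ u z').trans (Finset.sum_le_sum fun u _ => ?_)
    refine (traceNorm_sum_le _ fun z' _ => hherm _ u z').trans (Finset.sum_le_sum fun z' _ => ?_)
    exact traceNorm_real_smul_posSemidef (hpos u z') _
  have hprob : ∀ z, (Z.op z * s).trace = (outcomeProb (Z.op z) s : ℂ) := fun z =>
    trace_mul_eq_outcomeProb (Z.posSemidef z) hs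
  -- The partial trace is the sum of the contractions over all outcomes `z'`, so it absorbs the
  -- constant part of the coefficients; `hf` handles the part with `f`.
  have hDz : ∀ z, D z = partialContract (∑ u, τ u) (Z.op z) -
      outcomeProb (Z.op z) s • ptraceRight (∑ u, τ u) := fun z => by
    rw [hD, partialContract_sum_left, hf, ← partialContract_one, ← Z.sum_eq_one,
      partialContract_sum_left, Finset.smul_sum, ← Finset.sum_sub_distrib]
    refine Finset.sum_congr rfl fun u _ => ?_
    rw [partialContract_sum_right, Finset.smul_sum, ← Finset.sum_sub_distrib]
    exact Finset.sum_congr rfl fun z' _ => sub_smul _ _ _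
  have hkey : ∑ u, τ u - ptraceRight (∑ u, τ u) ⊗ₖ s = ∑ z, D z ⊗ₖ G z := by
    have h1 := hdual.eq_sum_kronecker (∑ u, τ u)
    have h2 := hdual.eq_sum s
    ext ⟨i, b⟩ ⟨j, b'⟩
    have h1' := congrFun (congrFun h1 (i, b)) (j, b')
    have h2' := congrFun (congrFun h2 b) b'
    simp only [hprob] at h2'
    rw [Matrix.sub_apply, h1', Matrix.kroneckerMap_apply, h2']
    simp only [Matrix.sum_apply _ _ Finset.univ, Matrix.kroneckerMap_apply, hDz, Matrix.sub_apply,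
      Matrix.smul_apply, Finset.mul_sum, ← Finset.sum_sub_distrib, Complex.real_smul, smul_eq_mul]
    exact Finset.sum_congr rfl fun z _ => by ring
  rw [hkey]
  refine (traceNorm_sum_le _ fun z _ => (hDherm z).kron (hG z)).trans
    (Finset.sum_le_sum fun z _ => ?_)
  refine (traceNorm_kronecker_le (hDherm z) (hG z)).trans ?_
  exact mul_le_mul_of_nonneg_right (hDnorm z) (traceNorm_nonneg _)

end OneStep

/-! ### Splitting off `n` copies by induction. -/

section Power

variable {α β ζ Ω : Type*} [Fintype α] [DecidableEq α] [Fintype β] [DecidableEq β] [Fintype ζ] [Fintype Ω]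

/-- The replacement hypothesis is required for arbitrary operators `M` on the other copies:
identities there restrict the family to fewer copies, and matrix units give the operator identity
for a single split. -/
theorem traceNorm_sub_kronecker_piTensor_le (Z : POVM ζ β) {G : ζ → Matrix β β ℂ}
    (hG : ∀ z, (G z).IsHermitian) (hdual : IsDualOf Z.op G) (f : Ω → ζ → ζ → ℝ)
    {s : Matrix β β ℂ} (hs : IsDensity s) {c : ζ → ℝ} (n : ℕ) :
    ∀ {τ : Ω → Matrix (α × (Fin n → β)) (α × (Fin n → β)) ℂ} (_ : ∀ u, (τ u).PosSemidef)
      (_ : ∀ (M : Fin n → Matrix β β ℂ) (i : Fin n) (z : ζ),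
        ∑ u, partialContract (τ u) (piTensor (Function.update M i (Z.op z))) =
        ∑ u, ∑ z', f u z' z •
          partialContract (τ u) (piTensor (Function.update M i (Z.op z'))))
      (_ : ∀ (i : Fin n) (z : ζ), ∑ u, ∑ z', |f u z' z - outcomeProb (Z.op z) s| *
        (partialContract (τ u) (piTensor (Function.update 1 i (Z.op z')))).trace.re ≤ c z),
      traceNorm (∑ u, τ u - ptraceRight (∑ u, τ u) ⊗ₖ piTensor fun _ : Fin n => s) ≤
        n * ∑ z, c z * traceNorm (G z) := by
  induction n with
  | zero =>
    intro τ hτ _ _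
    have h : ∑ u, τ u - ptraceRight (∑ u, τ u) ⊗ₖ piTensor (fun _ : Fin 0 => s) = 0 := by
      ext ⟨a, x⟩ ⟨a', y⟩
      simp [Matrix.kroneckerMap_apply, piTensor_apply, ptraceRight, Subsingleton.elim x default,
        Subsingleton.elim y default]
    rw [h, traceNorm_zero]
    simp
  | succ m ih =>
    intro τ hτ hf hc
    have hτ' : ∀ u, (splitSnoc (τ u)).PosSemidef := fun u => (hτ u).submatrix _
    have hone : ∀ W : Matrix (α × (Fin m → β)) (α × (Fin m → β)) ℂ,
        ptraceRight W = partialContract W (piTensor 1) := fun W => by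
      rw [← partialContract_one, ← piTensor_one]; rfl
    have hsnoc1 : ∀ X : Matrix β β ℂ, (Fin.snoc (1 : Fin m → Matrix β β ℂ) X :
        Fin (m + 1) → Matrix β β ℂ) =
        Function.update (1 : Fin (m + 1) → Matrix β β ℂ) (Fin.last m) X := fun X => by
      refine funext fun i => Fin.lastCases ?_ (fun i => ?_) i
      · simp
      · simp [Fin.castSucc_ne_last]
    have hupd : ∀ (M : Fin m → Matrix β β ℂ) i X, (Fin.snoc (Function.update M i X) 1 :
        Fin (m + 1) → Matrix β β ℂ) = Function.update (Fin.snoc M 1) i.castSucc X :=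
      fun M i X => by rw [Fin.snoc_update]
    have hsnoc_one : (Fin.snoc (1 : Fin m → Matrix β β ℂ) 1 : Fin (m + 1) → Matrix β β ℂ) = 1 := by
      rw [hsnoc1, Function.update_eq_self_iff]; rfl
    have h1 := ih (τ := fun u => ptraceRight (splitSnoc (τ u)))
      (fun u => posSemidef_ptraceRight (hτ' u))
      (fun M i z => by
        simp only [← partialContract_one (splitSnoc _), ← partialContract_snoc, hupd]
        exact hf _ _ _)
      (fun i z => by
        simp only [← partialContract_one (splitSnoc _), ← partialContract_snoc, hupd, hsnoc_one]
        exact hc _ _)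
    have hlast : ∀ u X, (partialContract (splitSnoc (τ u)) X).trace =
        (partialContract (τ u) (piTensor (Function.update 1 (Fin.last m) X))).trace := fun u X => by
      rw [← trace_ptraceRight, hone, ← partialContract_snoc, hsnoc1]
    -- Putting matrix units on the first `m` copies reads this identity off entry by entry.
    have h2f : ∀ z, ∑ u, partialContract (splitSnoc (τ u)) (Z.op z) =
        ∑ u, ∑ z', f u z' z • partialContract (splitSnoc (τ u)) (Z.op z') := fun z => by
      ext ⟨a, x⟩ ⟨a', y⟩
      have h := congrFun (congrFun (hf (Fin.snoc (fun i => Matrix.single (y i) (x i) 1) 1)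
        (Fin.last m) z) a) a'
      simpa only [Matrix.sum_apply, Matrix.smul_apply, Fin.update_snoc_last,
        partialContract_snoc, partialContract_single_piTensor] using h
    have h2c : ∀ z, ∑ u, ∑ z', |f u z' z - outcomeProb (Z.op z) s| *
        (partialContract (splitSnoc (τ u)) (Z.op z')).trace.re ≤ c z := fun z => by
      simp only [hlast]
      exact hc (Fin.last m) z
    have h2 := traceNorm_sub_kronecker_le Z hG hdual hτ' f h2f hs.1 h2c
    set T₁ := ∑ u, ptraceRight (splitSnoc (τ u)) with hT₁
    set T₂ := ∑ u, splitSnoc (τ u) with hT₂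
    have hT₁₂ : ptraceRight T₂ = T₁ := by
      simp only [hT₁, hT₂, ← partialContract_one, partialContract_sum_left]
    have hα : ptraceRight T₁ = ptraceRight (∑ u, τ u) := by
      rw [hone]
      simp only [hT₁, ← partialContract_one, partialContract_sum_left, ← partialContract_snoc,
        hsnoc_one]
      rw [← piTensor_one]; rfl
    rw [hα] at h1
    rw [hT₁₂] at h2
    have hT₂h : T₂.IsHermitian := Matrix.isHermitian_finset_sum _ fun u _ => (hτ' u).1
    have hT₁h : T₁.IsHermitian := hT₁₂ ▸ (posSemidef_ptraceRight
      (Matrix.posSemidef_sum _ fun u _ => hτ' u)).1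
    have hTh : (ptraceRight (∑ u, τ u)).IsHermitian := (posSemidef_ptraceRight
      (Matrix.posSemidef_sum _ fun u _ => hτ u)).1
    have hsn : (piTensor fun _ : Fin m => s).PosSemidef := posSemidef_piTensor fun _ => hs.1
    let e : α × (Fin (m + 1) → β) ≃ (α × (Fin m → β)) × β :=
      { toFun := fun p => ((p.1, Fin.init p.2), p.2 (Fin.last m))
        invFun := fun p => (p.1.1, Fin.snoc p.1.2 p.2)
        left_inv := fun p => by simp
        right_inv := fun p => by simp }
    -- Telescoping: replace the last copy by `s` first, then the remaining `m` copies; tensoring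
    -- with `s` costs nothing since `tr |s| = 1`.
    have hsplit : ∑ u, τ u - ptraceRight (∑ u, τ u) ⊗ₖ (piTensor fun _ : Fin (m + 1) => s) =
        ((T₂ - T₁ ⊗ₖ s) +
          (T₁ - ptraceRight (∑ u, τ u) ⊗ₖ piTensor fun _ : Fin m => s) ⊗ₖ s).submatrix e e := by
      have he : ∑ u, τ u = T₂.submatrix e e := by
        ext ⟨a, x⟩ ⟨a', y⟩
        simp [hT₂, e, splitSnoc, Matrix.sum_apply]
      ext ⟨a, x⟩ ⟨a', y⟩
      rw [Matrix.sub_apply, congrFun (congrFun he (a, x)) (a', y)]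
      simp only [e, Matrix.submatrix_apply, Matrix.add_apply, Matrix.sub_apply,
        Matrix.kroneckerMap_apply, Equiv.coe_fn_mk, piTensor_apply, Fin.prod_univ_castSucc,
        Fin.init]
      ring
    have hA : (T₂ - T₁ ⊗ₖ s).IsHermitian := hT₂h.sub (hT₁h.kron hs.1.1)
    have hB : (T₁ - ptraceRight (∑ u, τ u) ⊗ₖ piTensor fun _ : Fin m => s).IsHermitian :=
      hT₁h.sub (hTh.kron hsn.1)
    have hs1 : traceNorm s = 1 := by rw [traceNorm_of_posSemidef hs.1, hs.2, Complex.one_re]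
    rw [hsplit]
    have h3 := (traceNorm_kronecker_le hB hs.1.1).trans_eq (by rw [hs1, mul_one])
    refine (traceNorm_submatrix_le (hA.add (hB.kron hs.1.1)) e).trans
      ((traceNorm_add_le hA (hB.kron hs.1.1)).trans ?_)
    push_cast
    linarith

end Power

/-! ### Concentration of frequencies under exchange symmetry. -/

section Sampling

/-- Averaging over the sign of `v` turns the cross term into `cosh (2c⟨a, v⟩)`, which is at most
`exp (2c²⟨a, v⟩²)`; Cauchy–Schwarz bounds this by `exp (4c²‖a‖²)`. -/
theorem exp_norm_add_sq_add_exp_norm_sub_sq_le {E : Type*} [NormedAddCommGroup E]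
    [InnerProductSpace ℝ E] (a v : E) {c : ℝ} (hc : 0 ≤ c) (hv : ‖v‖ ^ 2 ≤ 2) :
    Real.exp (c * ‖a + v‖ ^ 2) + Real.exp (c * ‖a - v‖ ^ 2) ≤
      2 * (Real.exp (2 * c) * Real.exp ((c + 4 * c ^ 2) * ‖a‖ ^ 2)) := by
  set i := inner ℝ a v
  have hi : i ^ 2 ≤ ‖a‖ ^ 2 * 2 := by
    have h := abs_real_inner_le_norm a v
    calc i ^ 2 = |i| ^ 2 := (sq_abs i).symm
      _ ≤ (‖a‖ * ‖v‖) ^ 2 := by gcongr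
      _ = ‖a‖ ^ 2 * ‖v‖ ^ 2 := by ring
      _ ≤ ‖a‖ ^ 2 * 2 := by gcongr
  have h1 : Real.exp (c * ‖a + v‖ ^ 2) + Real.exp (c * ‖a - v‖ ^ 2) =
      2 * (Real.exp (c * (‖a‖ ^ 2 + ‖v‖ ^ 2)) * Real.cosh (2 * c * i)) := by
    rw [norm_add_sq_real, norm_sub_sq_real, Real.cosh_eq, mul_div_assoc',
      mul_add (Real.exp _), ← Real.exp_add, ← Real.exp_add, mul_div_cancel₀ _ (two_ne_zero (α := ℝ))]
    congr 2 <;> ring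
  rw [h1, ← Real.exp_add]
  refine mul_le_mul_of_nonneg_left ?_ zero_le_two
  refine (mul_le_mul_of_nonneg_left (Real.cosh_le_exp_half_sq _) (Real.exp_pos _).le).trans ?_
  rw [← Real.exp_add, Real.exp_le_exp]
  have h2 := mul_le_mul_of_nonneg_left hi (sq_nonneg c)
  have h3 := mul_le_mul_of_nonneg_left hv hc
  nlinarith

variable {ζ : Type*} {k : ℕ}

/-- Exchange the `l`-th entries of two tuples. -/
def swapEntry (l : Fin k) (p : (Fin k → ζ) × (Fin k → ζ)) : (Fin k → ζ) × (Fin k → ζ) :=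
  (Function.update p.1 l (p.2 l), Function.update p.2 l (p.1 l))

theorem swapEntry_involutive (l : Fin k) :
    Function.Involutive (swapEntry l : (Fin k → ζ) × (Fin k → ζ) → _) := fun p => by
  simp [swapEntry]

variable [DecidableEq ζ]

/-- The difference of the indicator vectors of the `l`-th entries of two tuples. -/
noncomputable def entryDiff (p : (Fin k → ζ) × (Fin k → ζ)) (l : Fin k) : EuclideanSpace ℝ ζ :=
  EuclideanSpace.single (p.2 l) 1 - EuclideanSpace.single (p.1 l) 1

theorem entryDiff_swapEntry_self (p : (Fin k → ζ) × (Fin k → ζ)) (l : Fin k) :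
    entryDiff (swapEntry l p) l = -entryDiff p l := by
  simp [entryDiff, swapEntry]

theorem entryDiff_swapEntry_of_ne (p : (Fin k → ζ) × (Fin k → ζ)) {l m : Fin k} (h : m ≠ l) :
    entryDiff (swapEntry l p) m = entryDiff p m := by
  simp [entryDiff, swapEntry, h]

theorem sum_entryDiff_apply (hk : 0 < k) (p : (Fin k → ζ) × (Fin k → ζ)) (z : ζ) :
    (∑ l, entryDiff p l) z = k * (freq p.2 z - freq p.1 z) := by
  have hk' : (k : ℝ) ≠ 0 := by exact_mod_cast hk.ne'
  rw [freq, freq, mul_sub, mul_div_cancel₀ _ hk', mul_div_cancel₀ _ hk', Finset.card_filter,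
    Finset.card_filter]
  push_cast
  rw [← Finset.sum_sub_distrib]
  simp [entryDiff, Finset.sum_apply, Pi.single_apply, eq_comm]

variable [Fintype ζ]

theorem norm_entryDiff_sq_le (p : (Fin k → ζ) × (Fin k → ζ)) (l : Fin k) :
    ‖entryDiff p l‖ ^ 2 ≤ 2 := by
  rw [entryDiff, norm_sub_sq_real]
  have h : 0 ≤ inner ℝ (EuclideanSpace.single (p.2 l) (1 : ℝ))
      (EuclideanSpace.single (p.1 l) (1 : ℝ)) := by
    rw [EuclideanSpace.inner_single_left]
    by_cases h : p.2 l = p.1 l <;> simp [h]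
  simp only [PiLp.norm_single, norm_one]
  linarith

/-- Each swap acts as a sign flip of one summand, so summands are removed one at a time. A removal
raises the exponent from `c` to `c + 4c²` and costs a factor `exp (2c)`; the condition on `c`
survives as `|S|` shrinks. -/
theorem sum_mul_exp_norm_sum_entryDiff_le {q : (Fin k → ζ) × (Fin k → ζ) → ℝ} (hq : ∀ p, 0 ≤ q p)
    (hswap : ∀ l p, q (swapEntry l p) = q p) (hk : 0 < k) (S : Finset (Fin k)) :
    ∀ c : ℝ, 0 ≤ c → c * (4 * (k + S.card)) ≤ 1 →
      ∑ p, q p * Real.exp (c * ‖∑ l ∈ S, entryDiff p l‖ ^ 2) ≤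
        Real.exp (S.card / (2 * k)) * ∑ p, q p := by
  have hk' : (0 : ℝ) < k := by exact_mod_cast hk
  induction S using Finset.induction_on with
  | empty => intro c _ _; simp
  | insert a S ha ih =>
    intro c hc hcS
    rw [Finset.card_insert_of_notMem ha] at hcS ⊢
    push_cast at hcS ⊢
    set D := fun p : (Fin k → ζ) × (Fin k → ζ) => ∑ l ∈ S, entryDiff p l
    have hsum : ∀ p, ∑ l ∈ insert a S, entryDiff p l = D p + entryDiff p a := fun p => by
      rw [Finset.sum_insert ha, add_comm]
    have hsum' : ∀ p, ∑ l ∈ insert a S, entryDiff (swapEntry a p) l = D p - entryDiff p a :=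
      fun p => by
        rw [Finset.sum_insert ha, entryDiff_swapEntry_self, sub_eq_neg_add,
          Finset.sum_congr rfl fun l hl => entryDiff_swapEntry_of_ne p (ne_of_mem_of_not_mem hl ha)]
    -- Reindexing by the swap of entry `a` preserves `q` and reverses only the summand of `a`.
    have hrefl : ∑ p, q p * Real.exp (c * ‖∑ l ∈ insert a S, entryDiff p l‖ ^ 2) =
        ∑ p, q p * Real.exp (c * ‖D p - entryDiff p a‖ ^ 2) := by
      rw [← Equiv.sum_comp (swapEntry_involutive a).toPerm]
      refine Finset.sum_congr rfl fun p _ => ?_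
      rw [Function.Involutive.coe_toPerm, hswap, hsum']
    have hs : (0 : ℝ) ≤ S.card := Nat.cast_nonneg _
    have h4 : 4 * c * k ≤ 1 := by nlinarith
    -- With `m = k + |S|` this is `1/(m+1) + 1/(m+1)² ≤ 1/m`, applied to `4c ≤ 1/(m+1)`.
    have hstep := ih (c + 4 * c ^ 2) (by positivity) (by nlinarith [sq_nonneg c])
    have hpt : ∑ p, q p * Real.exp (c * ‖∑ l ∈ insert a S, entryDiff p l‖ ^ 2) ≤
        Real.exp (2 * c) * ∑ p, q p * Real.exp ((c + 4 * c ^ 2) * ‖D p‖ ^ 2) := by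
      have h2 : ∑ p, q p * Real.exp (c * ‖D p + entryDiff p a‖ ^ 2) +
          ∑ p, q p * Real.exp (c * ‖D p - entryDiff p a‖ ^ 2) ≤
          2 * (Real.exp (2 * c) * ∑ p, q p * Real.exp ((c + 4 * c ^ 2) * ‖D p‖ ^ 2)) := by
        rw [← Finset.sum_add_distrib, Finset.mul_sum, Finset.mul_sum]
        refine Finset.sum_le_sum fun p _ => ?_
        have := mul_le_mul_of_nonneg_left (exp_norm_add_sq_add_exp_norm_sub_sq_le (D p)
          (entryDiff p a) hc (norm_entryDiff_sq_le p a)) (hq p)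
        linarith
      rw [← hrefl] at h2
      simp only [hsum] at h2 ⊢
      linarith
    refine hpt.trans ((mul_le_mul_of_nonneg_left hstep (Real.exp_pos _).le).trans ?_)
    rw [← mul_assoc, ← Real.exp_add]
    refine mul_le_mul_of_nonneg_right (Real.exp_le_exp.2 ?_) (Finset.sum_nonneg fun p _ => hq p)
    rw [add_div, add_comm]
    gcongr
    rw [le_div_iff₀ (by positivity)]
    linarith

theorem varDist_freq_sq_le (hk : 0 < k) (p : (Fin k → ζ) × (Fin k → ζ)) :
    varDist (freq p.1) (freq p.2) ^ 2 ≤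
      Fintype.card ζ / (4 * k ^ 2) * ‖∑ l, entryDiff p l‖ ^ 2 := by
  have hk' : (0 : ℝ) < k := by exact_mod_cast hk
  have h1 := sq_sum_le_card_mul_sum_sq (s := Finset.univ)
    (f := fun z => |freq p.1 z - freq p.2 z|)
  have h2 : ‖∑ l, entryDiff p l‖ ^ 2 = k ^ 2 * ∑ z, |freq p.1 z - freq p.2 z| ^ 2 := by
    rw [EuclideanSpace.norm_sq_eq, Finset.mul_sum]
    refine Finset.sum_congr rfl fun z _ => ?_
    rw [sum_entryDiff_apply hk, Real.norm_eq_abs, sq_abs, sq_abs]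
    ring
  rw [h2, varDist, mul_pow]
  rw [Finset.card_univ] at h1
  have : (Fintype.card ζ : ℝ) / (4 * k ^ 2) * (k ^ 2 * ∑ z, |freq p.1 z - freq p.2 z| ^ 2) =
      1 / 4 * (Fintype.card ζ * ∑ z, |freq p.1 z - freq p.2 z| ^ 2) := by
    field_simp
  rw [this]
  linarith

/-- For a law of two `k`-tuples that is invariant under exchanging corresponding entries, it is
unlikely that the conditional mean distance of their frequency distributions is large. -/
theorem sum_indicator_mean_varDist_ge_le {q : (Fin k → ζ) × (Fin k → ζ) → ℝ} (hq : ∀ p, 0 ≤ q p)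
    (hswap : ∀ l p, q (swapEntry l p) = q p) (hk : 0 < k) (hζ : 0 < Fintype.card ζ)
    {ε : ℝ} (hε : 0 ≤ ε) :
    ∑ x, Set.indicator {x | Real.sqrt (Fintype.card ζ / k) * ε * ∑ y, q (x, y) ≤
        ∑ y, q (x, y) * varDist (freq x) (freq y)} (fun x => ∑ y, q (x, y)) x ≤
      Real.exp (1 / 2 - ε ^ 2 / 2) * ∑ p, q p := by
  have hk' : (0 : ℝ) < k := by exact_mod_cast hk
  have ht : (0 : ℝ) < Fintype.card ζ := by exact_mod_cast hζ
  set t : ℝ := (Fintype.card ζ : ℝ)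
  set a := Real.sqrt (t / k) * ε with ha
  have ha0 : 0 ≤ a := by positivity
  set b := k / (2 * t) with hb
  have hb0 : 0 ≤ b := by positivity
  have hba : b * a ^ 2 = ε ^ 2 / 2 := by
    rw [hb, ha, mul_pow, Real.sq_sqrt (by positivity)]
    field_simp
  -- A tangent-line bound at `a`. Being affine in `x`, it can be averaged over `y`, so the
  -- exponential Markov bound applies to the conditional mean itself.
  have hexp : ∀ x : ℝ, Real.exp (ε ^ 2 / 2) * (1 + 2 * b * a * (x - a)) ≤ Real.exp (b * x ^ 2) :=
    fun x => by
      calc _ ≤ Real.exp (ε ^ 2 / 2) * Real.exp (2 * b * a * (x - a)) := by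
            gcongr
            linarith [Real.add_one_le_exp (2 * b * a * (x - a))]
        _ ≤ _ := by
            rw [← Real.exp_add, Real.exp_le_exp, ← hba]
            nlinarith [mul_nonneg hb0 (sq_nonneg (x - a))]
  have hmain : ∑ p, q p * Real.exp (b * varDist (freq p.1) (freq p.2) ^ 2) ≤
      Real.exp (1 / 2) * ∑ p, q p := by
    -- `1/(8k)` is the largest exponent allowed when `|S| = k`, and `b` is chosen so that `b *
    -- t/(4k²)` equals it.
    have h := sum_mul_exp_norm_sum_entryDiff_le hq hswap hk Finset.univ (1 / (8 * k))
      (by positivity) (by rw [Finset.card_univ, Fintype.card_fin]; field_simp; norm_num)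
    rw [Finset.card_univ, Fintype.card_fin] at h
    rw [show (k : ℝ) / (2 * k) = 1 / 2 by field_simp] at h
    refine le_trans (Finset.sum_le_sum fun p _ => mul_le_mul_of_nonneg_left ?_ (hq p)) h
    rw [Real.exp_le_exp]
    refine (mul_le_mul_of_nonneg_left (varDist_freq_sq_le hk p) hb0).trans (le_of_eq ?_)
    change k / (2 * t) * (t / (4 * k ^ 2) * _) = _
    field_simp
    ring
  have hpt : ∀ x, Real.exp (ε ^ 2 / 2) * Set.indicator {x | a * ∑ y, q (x, y) ≤
        ∑ y, q (x, y) * varDist (freq x) (freq y)} (fun x => ∑ y, q (x, y)) x ≤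
      ∑ y, q (x, y) * Real.exp (b * varDist (freq x) (freq y) ^ 2) := fun x => by
    by_cases hx : a * ∑ y, q (x, y) ≤ ∑ y, q (x, y) * varDist (freq x) (freq y)
    · rw [Set.indicator_of_mem (by exact hx)]
      have h1 : ∑ y, q (x, y) * (Real.exp (ε ^ 2 / 2) *
          (1 + 2 * b * a * (varDist (freq x) (freq y) - a))) ≤
          ∑ y, q (x, y) * Real.exp (b * varDist (freq x) (freq y) ^ 2) :=
        Finset.sum_le_sum fun y _ => mul_le_mul_of_nonneg_left (hexp _) (hq _)
      refine le_trans ?_ h1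
      have h2 : ∑ y, q (x, y) * (Real.exp (ε ^ 2 / 2) *
          (1 + 2 * b * a * (varDist (freq x) (freq y) - a))) =
          Real.exp (ε ^ 2 / 2) * (∑ y, q (x, y) + 2 * b * a *
            (∑ y, q (x, y) * varDist (freq x) (freq y) - a * ∑ y, q (x, y))) := by
        simp only [Finset.mul_sum, ← Finset.sum_sub_distrib, ← Finset.sum_add_distrib]
        exact Finset.sum_congr rfl fun y _ => by ring
      rw [h2]
      gcongr
      have : 0 ≤ 2 * b * a := by positivity
      nlinarith
    · rw [Set.indicator_of_notMem (by exact hx), mul_zero]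
      exact Finset.sum_nonneg fun y _ => mul_nonneg (hq _) (Real.exp_pos _).le
  have hsum := Finset.sum_le_sum fun x (_ : x ∈ Finset.univ) => hpt x
  rw [← Finset.mul_sum, ← Fintype.sum_prod_type'
    (f := fun x y => q (x, y) * Real.exp (b * varDist (freq x) (freq y) ^ 2))] at hsum
  have h := hsum.trans hmain
  rw [Real.exp_sub, div_mul_eq_mul_div, le_div_iff₀ (Real.exp_pos _)]
  linarith

end Sampling

/-! ### Replacing an outcome by a frequency, and mean deviations. -/

section Frequency

variable {ζ : Type*}

theorem freq_cons [DecidableEq ζ] {r : ℕ} (z' : ζ) (u : Fin r → ζ) (z : ζ) :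
    freq (Fin.cons z' u : Fin (r + 1) → ζ) z =
      ((if z' = z then 1 else 0) + ∑ l, if u l = z then 1 else 0) / (r + 1 : ℕ) := by
  rw [freq, Finset.card_filter, Fin.sum_univ_succ]
  simp

variable [Fintype ζ]

/-- If `H` is invariant under exchanging its second argument with any entry of the first one, the
frequency of `z` among all the arguments can be replaced by the indicator of the second one. -/
theorem sum_freq_cons_smul [DecidableEq ζ] {E : Type*} [AddCommGroup E] [Module ℝ E] {r : ℕ}
    {H : (Fin r → ζ) → ζ → E} (hH : ∀ l u z', H (Function.update u l z') (u l) = H u z') (z : ζ) :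
    ∑ u, ∑ z', freq (Fin.cons z' u : Fin (r + 1) → ζ) z • H u z' = ∑ u, H u z := by
  -- Exchanging `u l` with `z'` preserves `H` and moves the indicator onto `z'`. Thus all `r + 1`
  -- positions contribute equally to the frequency.
  have hl : ∀ l : Fin r, ∑ u, ∑ z', (if u l = z then (1 : ℝ) else 0) • H u z' = ∑ u, H u z := by
    intro l
    let e : (Fin r → ζ) × ζ → (Fin r → ζ) × ζ := fun p => (Function.update p.1 l p.2, p.1 l)
    have he : Function.Involutive e := fun p => by simp [e]
    rw [← Fintype.sum_prod_type' (f := fun (u : Fin r → ζ) (z' : ζ) =>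
      (if u l = z then (1 : ℝ) else 0) • H u z'), ← Equiv.sum_comp he.toPerm,
      Fintype.sum_prod_type]
    simp [e, hH]
  have h0 : ∑ u, ∑ z', (if z' = z then (1 : ℝ) else 0) • H u z' = ∑ u, H u z := by simp
  have hr : ((r + 1 : ℕ) : ℝ) ≠ 0 := by positivity
  have h : ∀ u z', freq (Fin.cons z' u : Fin (r + 1) → ζ) z • H u z' =
      ((r + 1 : ℕ) : ℝ)⁻¹ • ((if z' = z then (1 : ℝ) else 0) • H u z' +
        ∑ l, (if u l = z then (1 : ℝ) else 0) • H u z') := fun u z' => by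
    rw [freq_cons, ← Finset.sum_smul, ← add_smul, smul_smul, div_eq_inv_mul]
  simp only [h, ← Finset.smul_sum, Finset.sum_add_distrib]
  rw [h0]
  have h1 : ∑ u, ∑ z', ∑ l, (if u l = z then (1 : ℝ) else 0) • H u z' =
      ∑ l : Fin r, ∑ u, H u z := by
    refine (Finset.sum_congr rfl fun u _ => Finset.sum_comm).trans (Finset.sum_comm.trans ?_)
    exact Finset.sum_congr rfl fun l _ => hl l
  rw [h1, Finset.sum_const, Finset.card_univ, Fintype.card_fin, ← Nat.cast_smul_eq_nsmul ℝ,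
    inv_smul_eq_iff₀ hr, Nat.cast_succ, add_smul, one_smul, add_comm]

theorem abs_sub_le_two_mul_varDist (P Q : ζ → ℝ) (z : ζ) : |P z - Q z| ≤ 2 * varDist P Q := by
  rw [varDist, ← mul_assoc, mul_one_div_cancel two_ne_zero, one_mul]
  exact Finset.single_le_sum (f := fun z => |P z - Q z|) (fun z _ => abs_nonneg _)
    (Finset.mem_univ z)

theorem varDist_mean_le {Ω : Type*} [Fintype Ω] {w : Ω → ℝ} (hw : ∀ v, 0 ≤ w v)
    (hw1 : ∑ v, w v = 1) (f : Ω → ζ → ℝ) (Q : ζ → ℝ) :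
    varDist (fun z => ∑ v, w v * f v z) Q ≤ ∑ v, w v * varDist Q (f v) := by
  simp only [varDist, mul_left_comm _ (1 / 2 : ℝ), Finset.mul_sum]
  rw [Finset.sum_comm]
  refine Finset.sum_le_sum fun z _ => ?_
  rw [← Finset.mul_sum]
  refine mul_le_mul_of_nonneg_left ?_ (by norm_num)
  have h : ∑ v, w v * f v z - Q z = ∑ v, w v * (f v z - Q z) := by
    simp only [mul_sub, Finset.sum_sub_distrib, ← Finset.sum_mul, hw1, one_mul]
  rw [h]
  refine (Finset.abs_sum_le_sum_abs _ _).trans (le_of_eq (Finset.sum_congr rfl fun v _ => ?_))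
  rw [abs_mul, abs_of_nonneg (hw v), abs_sub_comm]

/-- Compare with `Q z` in between: both the distance of `f v z` to `Q z`, on average, and that of
the mean to `Q z` cost twice the mean variational distance. -/
theorem sum_mul_abs_sub_mean_le {Ω : Type*} [Fintype Ω] {w : Ω → ℝ} (hw : ∀ v, 0 ≤ w v)
    (hw1 : ∑ v, w v = 1) (f : Ω → ζ → ℝ) (Q : ζ → ℝ) (z : ζ) :
    ∑ v, w v * |f v z - ∑ v, w v * f v z| ≤ 4 * ∑ v, w v * varDist Q (f v) := by
  have h1 := (abs_sub_le_two_mul_varDist _ Q z).trans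
    (mul_le_mul_of_nonneg_left (varDist_mean_le hw hw1 f Q) zero_le_two)
  set m := ∑ v, w v * f v z
  have h2 : ∑ v, w v * |f v z - m| ≤ ∑ v, w v * (2 * varDist Q (f v) + |m - Q z|) := by
    refine Finset.sum_le_sum fun v _ => mul_le_mul_of_nonneg_left ?_ (hw v)
    have h3 := abs_sub_le_two_mul_varDist Q (f v) z
    rw [abs_sub_comm] at h3
    have h4 := abs_sub_le (f v z) (Q z) m
    rw [abs_sub_comm (Q z) m] at h4
    linarith
  simp only [mul_add, Finset.sum_add_distrib, ← Finset.sum_mul, hw1, mul_left_comm _ (2 : ℝ),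
    ← Finset.mul_sum] at h2
  linarith

end Frequency

/-! ### Updates of appended tuples and transpositions of copies. -/

section Append

theorem Fin.append_update_left {X : Type*} {n r : ℕ} (M : Fin n → X) (N : Fin r → X) (i : Fin n)
    (a : X) : Fin.append (Function.update M i a) N =
      Function.update (Fin.append M N) (Fin.castAdd r i) a := by
  refine funext fun j => Fin.addCases (fun j => ?_) (fun j => ?_) j
  · by_cases h : j = i
    · subst h; simp
    · have : Fin.castAdd r j ≠ Fin.castAdd r i := fun h' => h (Fin.castAdd_injective _ _ h')
      simp [h, this]
  · have : Fin.natAdd n j ≠ Fin.castAdd r i := fun h => by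
      have := congrArg Fin.val h
      simp at this
      omega
    simp [this]

theorem Fin.append_update_right {X : Type*} {n r : ℕ} (M : Fin n → X) (N : Fin r → X) (i : Fin r)
    (a : X) : Fin.append M (Function.update N i a) =
      Function.update (Fin.append M N) (Fin.natAdd n i) a := by
  refine funext fun j => Fin.addCases (fun j => ?_) (fun j => ?_) j
  · have : Fin.castAdd r j ≠ Fin.natAdd n i := fun h => by
      have := congrArg Fin.val h
      simp at this
      omega
    simp [this]
  · by_cases h : j = i
    · subst h; simp
    · have : Fin.natAdd n j ≠ Fin.natAdd n i := fun h' => h (Fin.natAdd_injective _ _ h')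
      simp [h, this]

variable {α β ζ : Type*}

theorem partialContract_update_comm [Fintype α] [DecidableEq α] [Fintype β] [DecidableEq β]
    {n : ℕ} {W : Matrix (α × (Fin n → β)) (α × (Fin n → β)) ℂ} (hW : IsSymmetricRel W)
    (M : Fin n → Matrix β β ℂ) {i j : Fin n} (hij : i ≠ j) (X Y : Matrix β β ℂ) :
    partialContract W (piTensor (Function.update (Function.update M i X) j Y)) =
      partialContract W (piTensor (Function.update (Function.update M i Y) j X)) := by
  rw [← partialContract_piTensor_comp hW (Equiv.swap i j)
    (Function.update (Function.update M i X) j Y), Equiv.comp_swap_eq_update]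
  congr 2
  funext t
  by_cases h1 : t = i
  · subst h1; simp [hij]
  · by_cases h2 : t = j
    · subst h2; simp [hij, hij.symm]
    · simp [h1, h2]

theorem splitLast_sum {s : Type*} (S : Finset s) {n r : ℕ}
    (W : s → Matrix (α × (Fin (n + r) → β)) (α × (Fin (n + r) → β)) ℂ) :
    splitLast (∑ u ∈ S, W u) = ∑ u ∈ S, splitLast (W u) := by
  ext
  simp [splitLast, Matrix.sum_apply]

theorem trace_splitLast [Fintype α] [Fintype β] {n r : ℕ}
    (W : Matrix (α × (Fin (n + r) → β)) (α × (Fin (n + r) → β)) ℂ) :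
    (splitLast W).trace = W.trace := by
  simp only [Matrix.trace, Fintype.sum_prod_type, Matrix.diag_apply, splitLast,
    Matrix.submatrix_apply]
  refine Finset.sum_congr rfl fun a _ => ?_
  rw [← (Fin.appendEquiv n r).sum_comp, Fintype.sum_prod_type]
  rfl

theorem POVM.sum_piTensor_op [Fintype β] [DecidableEq β] [Fintype ζ] [DecidableEq ζ]
    (Z : POVM ζ β) (r : ℕ) : ∑ u : Fin r → ζ, piTensor (fun i => Z.op (u i)) = 1 := by
  rw [sum_piTensor, Z.sum_eq_one, piTensor_one]

theorem POVM.op_update [Fintype β] [DecidableEq β] [Fintype ζ] (Z : POVM ζ β) {r : ℕ}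
    (u : Fin r → ζ) (l : Fin r) (z : ζ) : (fun i => Z.op (Function.update u l z i)) =
      Function.update (fun i => Z.op (u i)) l (Z.op z) :=
  funext fun i => Function.apply_update (fun _ => Z.op) u l z i

end Append

/-! ### Joint outcomes on the middle and last copies, and their exchange symmetries. -/

section Joint

variable {α β ζ : Type*} [Fintype β] [DecidableEq β] [Fintype ζ] {n k r : ℕ}

/-- The operator on `A` left after contracting the first `n` copies of `H` with `M` and measuring
outcomes `x` and `u` on the next `k` and `r` copies. -/
def POVM.joint (Z : POVM ζ β)
    (σ : Matrix (α × (Fin (n + k + r) → β)) (α × (Fin (n + k + r) → β)) ℂ)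
    (M : Fin n → Matrix β β ℂ) (x : Fin k → ζ) (u : Fin r → ζ) : Matrix α α ℂ :=
  partialContract σ (piTensor (Fin.append (Fin.append M fun i => Z.op (x i)) fun i => Z.op (u i)))

/-- The unnormalized state on `A ⊗ H^{⊗ n}` after outcomes `x` and `u` on the next `k` and `r`
copies of `H`. -/
def POVM.subState (Z : POVM ζ β)
    (σ : Matrix (α × (Fin (n + k + r) → β)) (α × (Fin (n + k + r) → β)) ℂ)
    (x : Fin k → ζ) (u : Fin r → ζ) : Matrix (α × (Fin n → β)) (α × (Fin n → β)) ℂ :=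
  partialContract (splitLast (partialContract (splitLast σ) (piTensor fun i => Z.op (u i))))
    (piTensor fun i => Z.op (x i))

variable (Z : POVM ζ β)
  {σ : Matrix (α × (Fin (n + k + r) → β)) (α × (Fin (n + k + r) → β)) ℂ}

theorem POVM.partialContract_subState (M : Fin n → Matrix β β ℂ) (x : Fin k → ζ) (u : Fin r → ζ) :
    partialContract (Z.subState σ x u) (piTensor M) = Z.joint σ M x u := by
  rw [subState, joint, partialContract_append, partialContract_append]

theorem POVM.sum_subState [DecidableEq ζ] (x : Fin k → ζ) :
    ∑ u, Z.subState σ x u =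
      partialContract (splitLast (ptraceRight (splitLast σ))) (piTensor fun i => Z.op (x i)) := by
  rw [← partialContract_one, ← Z.sum_piTensor_op, partialContract_sum_right, splitLast_sum,
    partialContract_sum_left]
  rfl

variable [Fintype α] [DecidableEq α]

theorem POVM.joint_exchange_right (hσ : IsSymmetricRel σ) (M : Fin n → Matrix β β ℂ)
    (i : Fin n) (x : Fin k → ζ) (u : Fin r → ζ) (l : Fin r) (z : ζ) :
    Z.joint σ (Function.update M i (Z.op (u l))) x (Function.update u l z) =
      Z.joint σ (Function.update M i (Z.op z)) x u := by
  have hne : Fin.natAdd (n + k) l ≠ Fin.castAdd r (Fin.castAdd k i) := fun h => by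
    have := congrArg Fin.val h
    simp at this
    omega
  simp only [joint, Z.op_update, Fin.append_update_left, Fin.append_update_right]
  rw [Function.update_comm hne.symm, partialContract_update_comm hσ _ hne]
  congr 3
  rw [Function.update_eq_self_iff, Fin.append_right]

theorem POVM.joint_exchange_left (hσ : IsSymmetricRel σ) (M : Fin n → Matrix β β ℂ)
    (i : Fin n) (x : Fin k → ζ) (u : Fin r → ζ) (l : Fin k) (z : ζ) :
    Z.joint σ (Function.update M i (Z.op (x l))) (Function.update x l z) u =
      Z.joint σ (Function.update M i (Z.op z)) x u := by
  have hne : Fin.castAdd r (Fin.natAdd n l) ≠ Fin.castAdd r (Fin.castAdd k i) := fun h => by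
    have := congrArg Fin.val h
    simp at this
    omega
  simp only [joint, Z.op_update, Fin.append_update_left, Fin.append_update_right]
  rw [Function.update_comm hne.symm, partialContract_update_comm hσ _ hne]
  congr 3
  rw [Function.update_eq_self_iff, Fin.append_left, Fin.append_right]

theorem POVM.joint_exchange_outcomes (hσ : IsSymmetricRel σ) (M : Fin n → Matrix β β ℂ)
    (x : Fin k → ζ) (u : Fin r → ζ) (l : Fin k) (m : Fin r) :
    Z.joint σ M (Function.update x l (u m)) (Function.update u m (x l)) = Z.joint σ M x u := by
  have hne : Fin.castAdd r (Fin.natAdd n l) ≠ Fin.natAdd (n + k) m := fun h => by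
    have := congrArg Fin.val h
    simp at this
    omega
  simp only [joint, Z.op_update, Fin.append_update_left, Fin.append_update_right]
  rw [partialContract_update_comm hσ _ hne]
  congr 2
  rw [Function.update_eq_iff]
  refine ⟨by rw [Fin.append_right], fun t _ => congrFun (Function.update_eq_self_iff.2 ?_) t⟩
  rw [Fin.append_left, Fin.append_right]

/-- All `n` kept copies have the same marginal given the outcomes, so nothing depends on the choice
of `j`. -/
theorem POVM.joint_update_one (hσ : IsSymmetricRel σ) (X : Matrix β β ℂ)
    (i j : Fin n) (x : Fin k → ζ) (u : Fin r → ζ) :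
    Z.joint σ (Function.update 1 i X) x u = Z.joint σ (Function.update 1 j X) x u := by
  by_cases hij : i = j
  · rw [hij]
  have hne : Fin.castAdd r (Fin.castAdd k i) ≠ Fin.castAdd r (Fin.castAdd k j) := fun h =>
    hij (Fin.castAdd_injective _ _ (Fin.castAdd_injective _ _ h))
  have h1 : ∀ i : Fin n, Function.update (1 : Fin n → Matrix β β ℂ) i 1 = 1 := fun i => by
    rw [Function.update_eq_self_iff]; rfl
  have h2 : Function.update (1 : Fin n → Matrix β β ℂ) i X =
      Function.update (Function.update (1 : Fin n → Matrix β β ℂ) i X) j 1 := by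
    rw [Function.update_comm hij, h1]
  rw [h2]
  simp only [joint, Fin.append_update_left]
  rw [partialContract_update_comm hσ _ hne]
  simp only [← Fin.append_update_left, h1]

theorem POVM.posSemidef_joint (hσ : σ.PosSemidef) {M : Fin n → Matrix β β ℂ}
    (hM : ∀ i, (M i).PosSemidef) (x : Fin k → ζ) (u : Fin r → ζ) :
    (Z.joint σ M x u).PosSemidef := by
  refine posSemidef_partialContract hσ (posSemidef_piTensor fun i => ?_)
  refine Fin.addCases (fun i => ?_) (fun i => ?_) i
  · rw [Fin.append_left]
    refine Fin.addCases (fun i => ?_) (fun i => ?_) i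
    · rw [Fin.append_left]; exact hM i
    · rw [Fin.append_right]; exact Z.posSemidef _
  · rw [Fin.append_right]; exact Z.posSemidef _

theorem POVM.posSemidef_subState (hσ : σ.PosSemidef) (x : Fin k → ζ) (u : Fin r → ζ) :
    (Z.subState σ x u).PosSemidef :=
  posSemidef_partialContract ((posSemidef_partialContract (hσ.submatrix _)
    (posSemidef_piTensor fun _ => Z.posSemidef _)).submatrix _)
    (posSemidef_piTensor fun _ => Z.posSemidef _)

end Joint

/-! ### The exchange-invariant law of two `k`-tuples of outcomes. -/

section Law

variable {α β ζ : Type*} [Fintype β] [DecidableEq β] [Fintype ζ] {n r : ℕ} (Z : POVM ζ β)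

theorem sum_cons {r : ℕ} (g : (Fin (r + 1) → ζ) → ℝ) :
    ∑ v, g v = ∑ u : Fin r → ζ, ∑ z : ζ, g (Fin.cons z u) := by
  rw [← (Fin.consEquiv fun _ => ζ).sum_comp, Fintype.sum_prod_type, Finset.sum_comm]
  rfl

theorem partialContract_update_one (W : Matrix (α × (Fin n → β)) (α × (Fin n → β)) ℂ) (j : Fin n) :
    partialContract W (piTensor (Function.update 1 j 1)) = ptraceRight W := by
  have h : Function.update (1 : Fin n → Matrix β β ℂ) j 1 = fun _ => 1 :=
    Function.update_eq_self_iff.2 rfl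
  rw [h, ← partialContract_one, ← piTensor_one]

theorem partialContract_update_sum (W : Matrix (α × (Fin n → β)) (α × (Fin n → β)) ℂ) (j : Fin n)
    (F : ζ → Matrix β β ℂ) : partialContract W (piTensor (Function.update 1 j (∑ z, F z))) =
      ∑ z, partialContract W (piTensor (Function.update 1 j (F z))) := by
  rw [← partialContract_sum_right]
  congr 1
  ext x y
  simp only [piTensor_apply, Matrix.sum_apply]
  simp only [← Finset.mul_prod_erase _ _ (Finset.mem_univ j), Function.update_self,
    Matrix.sum_apply, Finset.sum_mul]
  refine Finset.sum_congr rfl fun z _ => ?_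
  congr 1
  refine Finset.prod_congr rfl fun i hi => ?_
  rw [Function.update_of_ne (Finset.ne_of_mem_erase hi),
    Function.update_of_ne (Finset.ne_of_mem_erase hi)]

variable [Fintype α]

theorem POVM.sum_outcomeDist [DecidableEq ζ] {k : ℕ} {ρ : Matrix (α × (Fin (n + k) → β)) (α × (Fin (n + k) → β)) ℂ}
    (hρ : IsDensity ρ) : ∑ x, Z.outcomeDist ρ x = 1 := by
  simp only [outcomeDist, outcomeProb_ptraceLeft]
  rw [← Complex.re_sum, ← Matrix.trace_sum, ← partialContract_sum_right, Z.sum_piTensor_op,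
    partialContract_one, trace_ptraceRight, trace_splitLast, hρ.2, Complex.one_re]

/-- The joint probability of the outcomes `p.1` on the middle copies of `H` and of the outcomes
`p.2` on the `j`-th and on the last copies of `H`. -/
noncomputable def POVM.law (Z : POVM ζ β)
    (σ : Matrix (α × (Fin (n + (r + 1) + r) → β)) (α × (Fin (n + (r + 1) + r) → β)) ℂ)
    (j : Fin n) (p : (Fin (r + 1) → ζ) × (Fin (r + 1) → ζ)) : ℝ :=
  (Z.joint σ (Function.update 1 j (Z.op (p.2 0))) p.1 (Fin.tail p.2)).trace.re

variable {σ : Matrix (α × (Fin (n + (r + 1) + r) → β)) (α × (Fin (n + (r + 1) + r) → β)) ℂ}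

theorem POVM.law_cons (j : Fin n) (x : Fin (r + 1) → ζ) (z : ζ) (u : Fin r → ζ) :
    Z.law σ j (x, Fin.cons z u) =
      (partialContract (Z.subState σ x u) (piTensor (Function.update 1 j (Z.op z)))).trace.re := by
  rw [Z.partialContract_subState, law]
  simp

theorem POVM.sum_law [DecidableEq ζ] (j : Fin n) (x : Fin (r + 1) → ζ) :
    ∑ v, Z.law σ j (x, v) = Z.outcomeDist (ptraceRight (splitLast σ)) x := by
  rw [outcomeDist, outcomeProb_ptraceLeft, ← Z.sum_subState, sum_cons, Matrix.trace_sum,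
    Complex.re_sum]
  refine Finset.sum_congr rfl fun u _ => ?_
  simp only [Z.law_cons]
  rw [← Complex.re_sum, ← Matrix.trace_sum, ← partialContract_update_sum, Z.sum_eq_one,
    partialContract_update_one, trace_ptraceRight]

variable [DecidableEq α]

theorem POVM.law_nonneg (hσ : σ.PosSemidef) (j : Fin n)
    (p : (Fin (r + 1) → ζ) × (Fin (r + 1) → ζ)) : 0 ≤ Z.law σ j p := by
  refine (Z.posSemidef_joint hσ (fun i => ?_) _ _).trace_re_nonneg
  by_cases h : i = j
  · subst h; simpa using Z.posSemidef _
  · simpa [h] using Matrix.PosSemidef.one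

/-- Entry `0` of the second tuple sits on the kept copy `j` and entry `l + 1` on the extra copy `l`;
each swap is a transposition with a middle copy. -/
theorem POVM.law_swapEntry (hσ : IsSymmetricRel σ) (j : Fin n) (l : Fin (r + 1))
    (p : (Fin (r + 1) → ζ) × (Fin (r + 1) → ζ)) : Z.law σ j (swapEntry l p) = Z.law σ j p := by
  refine Fin.cases ?_ (fun l => ?_) l
  · simp only [law, swapEntry, Function.update_self, Fin.tail_update_zero]
    rw [Z.joint_exchange_left hσ]
  · simp only [law, swapEntry, Fin.tail_update_succ, Function.update_of_ne (Fin.succ_ne_zero l).symm]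
    rw [← Z.joint_exchange_outcomes hσ _ p.1 (Fin.tail p.2) l.succ l]
    rfl

theorem POVM.law_index (hσ : IsSymmetricRel σ) (i j : Fin n)
    (p : (Fin (r + 1) → ζ) × (Fin (r + 1) → ζ)) : Z.law σ i p = Z.law σ j p := by
  rw [law, Z.joint_update_one hσ _ i j, law]

end Law

/-! ### The state conditioned on the middle outcomes. -/

section Conditional

variable {α β ζ : Type*} [Fintype α] [Fintype β] [DecidableEq β]

theorem isDensity_singleSystem {n : ℕ} (j : Fin n)
    {W : Matrix (α × (Fin n → β)) (α × (Fin n → β)) ℂ} (hW : IsDensity W) :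
    IsDensity (singleSystem j W) := by
  refine ⟨posSemidef_singleSystem j hW.1, ?_⟩
  rw [← one_mul (singleSystem j W), trace_mul_singleSystem, partialContract_update_one,
    trace_ptraceRight, hW.2]

variable [DecidableEq α] [Fintype ζ] [DecidableEq ζ] {n r : ℕ} (Z : POVM ζ β)
  {σ : Matrix (α × (Fin (n + (r + 1) + r) → β)) (α × (Fin (n + (r + 1) + r) → β)) ℂ}

theorem POVM.condOn_eq (hσ : σ.PosSemidef) (x : Fin (r + 1) → ζ) :
    Z.condOn (ptraceRight (splitLast σ)) x =
      ∑ u, (Z.outcomeDist (ptraceRight (splitLast σ)) x)⁻¹ • Z.subState σ x u := by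
  have h : (∑ u, Z.subState σ x u).PosSemidef :=
    Matrix.posSemidef_sum _ fun u _ => Z.posSemidef_subState hσ x u
  rw [condOn, condState_eq, outcomeDist, outcomeProb_ptraceLeft, ← Z.sum_subState,
    h.trace_eq_re, Complex.ofReal_re, ← Finset.smul_sum]
  ext i j
  simp

theorem POVM.isDensity_condOn (hσ : σ.PosSemidef) {x : Fin (r + 1) → ζ}
    (hx : 0 < Z.outcomeDist (ptraceRight (splitLast σ)) x) :
    IsDensity (Z.condOn (ptraceRight (splitLast σ)) x) := by
  have h : (∑ u, Z.subState σ x u).PosSemidef :=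
    Matrix.posSemidef_sum _ fun u _ => Z.posSemidef_subState hσ x u
  have hx' := hx.ne'
  rw [Z.condOn_eq hσ, ← Finset.smul_sum]
  refine ⟨h.real_smul (inv_nonneg.2 hx.le), ?_⟩
  rw [outcomeDist, outcomeProb_ptraceLeft, ← Z.sum_subState] at hx' ⊢
  rw [Matrix.trace_smul, h.trace_eq_re, Complex.ofReal_re, Complex.real_smul,
    ← Complex.ofReal_mul, inv_mul_cancel₀ hx', Complex.ofReal_one]

theorem POVM.sum_freq_smul_subState (hσ : IsSymmetricRel σ) (x : Fin (r + 1) → ζ) (c : ℝ)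
    (M : Fin n → Matrix β β ℂ) (i : Fin n) (z : ζ) :
    ∑ u, partialContract (c • Z.subState σ x u) (piTensor (Function.update M i (Z.op z))) =
      ∑ u, ∑ z', freq (Fin.cons z' u : Fin (r + 1) → ζ) z •
        partialContract (c • Z.subState σ x u) (piTensor (Function.update M i (Z.op z'))) := by
  have h := sum_freq_cons_smul (H := fun u z' => c • Z.joint σ (Function.update M i (Z.op z')) x u)
    (fun l u z' => by rw [Z.joint_exchange_right hσ]) z
  simp only [partialContract_smul_left, Z.partialContract_subState]
  exact h.symm

/-- The conditional law of the outcomes on the `j`-th and on the last copies of `H`. -/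
noncomputable def POVM.condLaw (Z : POVM ζ β)
    (σ : Matrix (α × (Fin (n + (r + 1) + r) → β)) (α × (Fin (n + (r + 1) + r) → β)) ℂ)
    (j : Fin n) (x v : Fin (r + 1) → ζ) : ℝ :=
  (Z.outcomeDist (ptraceRight (splitLast σ)) x)⁻¹ * Z.law σ j (x, v)

/-- Taking traces in the replacement of an outcome by a frequency: the centre around which the
frequencies must concentrate is exactly their conditional mean. -/
theorem POVM.outcomeProb_singleSystem_condOn (hσ : σ.PosSemidef) (hsym : IsSymmetricRel σ)
    (j : Fin n) (x : Fin (r + 1) → ζ) (z : ζ) :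
    outcomeProb (Z.op z) (singleSystem j (Z.condOn (ptraceRight (splitLast σ)) x)) =
      ∑ v, Z.condLaw σ j x v * freq v z := by
  rw [outcomeProb, trace_mul_singleSystem, Z.condOn_eq hσ, partialContract_sum_left,
    Z.sum_freq_smul_subState hsym, sum_cons]
  simp only [Matrix.trace_sum, Complex.re_sum]
  refine Finset.sum_congr rfl fun u _ => Finset.sum_congr rfl fun z' _ => ?_
  rw [condLaw, Z.law_cons, partialContract_smul_left, Matrix.trace_smul, Matrix.trace_smul,
    Complex.real_smul, Complex.real_smul, Complex.re_ofReal_mul, Complex.re_ofReal_mul, mul_comm]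

/-- If the conditional mean distance between the observed frequencies and those of an independent
sample is at most `e`, the conditional state is close to a product. -/
theorem POVM.traceDist_condOn_le (hσ : σ.PosSemidef) (hsym : IsSymmetricRel σ) (j : Fin n)
    {x : Fin (r + 1) → ζ} (hx : 0 < Z.outcomeDist (ptraceRight (splitLast σ)) x)
    {e : ℝ} (he : ∑ v, Z.condLaw σ j x v * varDist (freq x) (freq v) ≤ e)
    (hw : ∀ v, 0 ≤ Z.condLaw σ j x v) (hw1 : ∑ v, Z.condLaw σ j x v = 1)
    {G : ζ → Matrix β β ℂ} (hG : ∀ z, (G z).IsHermitian) (hdual : IsDualOf Z.op G) :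
    traceDist (Z.condOn (ptraceRight (splitLast σ)) x)
      (ptraceRight (Z.condOn (ptraceRight (splitLast σ)) x) ⊗ₖ
        piTensor fun _ : Fin n => singleSystem j (Z.condOn (ptraceRight (splitLast σ)) x)) ≤
      n * e * (2 * ∑ z, traceNorm (G z)) := by
  have hs := isDensity_singleSystem j (Z.isDensity_condOn hσ hx)
  have hcond := Z.condOn_eq hσ x
  have hc : ∀ (i : Fin n) (z : ζ), ∑ u, ∑ z', |freq (Fin.cons z' u : Fin (r + 1) → ζ) z -
        outcomeProb (Z.op z) (singleSystem j (Z.condOn (ptraceRight (splitLast σ)) x))| *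
        (partialContract ((Z.outcomeDist (ptraceRight (splitLast σ)) x)⁻¹ • Z.subState σ x u)
          (piTensor (Function.update 1 i (Z.op z')))).trace.re ≤ 4 * e := fun i z => by
    have hmean := sum_mul_abs_sub_mean_le hw hw1 (fun v => freq v) (freq x) z
    rw [← Z.outcomeProb_singleSystem_condOn hσ hsym, sum_cons] at hmean
    refine le_trans (le_of_eq ?_) (hmean.trans (mul_le_mul_of_nonneg_left he (by norm_num)))
    refine Finset.sum_congr rfl fun u _ => Finset.sum_congr rfl fun z' _ => ?_
    rw [condLaw, Z.law_index hsym j i, Z.law_cons, partialContract_smul_left, Matrix.trace_smul,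
      Complex.real_smul, Complex.re_ofReal_mul, mul_comm]
  have h := traceNorm_sub_kronecker_piTensor_le Z hG hdual
    (fun (u : Fin r → ζ) z' => freq (Fin.cons z' u : Fin (r + 1) → ζ)) hs n
    (fun u => (Z.posSemidef_subState hσ x u).real_smul (inv_nonneg.2 hx.le))
    (fun M i z => Z.sum_freq_smul_subState hsym x _ M i z) hc
  rw [← hcond] at h
  -- The factor `1/2` turns the deviation bound `4 * e` into `2 * e`, which is where the `2` in `C₁`
  -- comes from.
  rw [traceDist]
  rw [← Finset.mul_sum] at h
  linarith

theorem POVM.ofReal_traceDist_condOn_lt (hσ : σ.PosSemidef) (hsym : IsSymmetricRel σ) (j : Fin n)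
    {x : Fin (r + 1) → ζ} (hx : 0 < Z.outcomeDist (ptraceRight (splitLast σ)) x)
    {a : ℝ} (ha : ∑ v, Z.condLaw σ j x v * varDist (freq x) (freq v) < a)
    (hw : ∀ v, 0 ≤ Z.condLaw σ j x v) (hw1 : ∑ v, Z.condLaw σ j x v = 1) :
    ENNReal.ofReal (traceDist (Z.condOn (ptraceRight (splitLast σ)) x)
      (ptraceRight (Z.condOn (ptraceRight (splitLast σ)) x) ⊗ₖ
        piTensor fun _ : Fin n => singleSystem j (Z.condOn (ptraceRight (splitLast σ)) x))) <
      ENNReal.ofReal (n * a) * Z.C1 := by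
  -- Passing to the infimum over `G` gives only `≤`; the room between `e` and `a` restores
  -- strictness when `C₁` is finite and nonzero.
  obtain ⟨e, he, hea⟩ := exists_between ha
  have he0 : 0 < e := lt_of_le_of_lt (Finset.sum_nonneg fun v _ => mul_nonneg (hw v)
    (by rw [varDist]; positivity)) he
  have hn : (0 : ℝ) < n := by exact_mod_cast j.pos
  have hC : Z.C1 ≠ 0 := (zero_lt_one.trans_le
    (Z.one_le_C1 (isDensity_singleSystem j (Z.isDensity_condOn hσ hx)))).ne'
  by_cases htop : Z.C1 = ⊤
  · rw [htop, ENNReal.mul_top (ENNReal.ofReal_pos.2 (mul_pos hn (he0.trans hea))).ne']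
    exact ENNReal.ofReal_lt_top
  have hne0 : ENNReal.ofReal (n * e) ≠ 0 := (ENNReal.ofReal_pos.2 (mul_pos hn he0)).ne'
  calc _ ≤ ENNReal.ofReal (n * e) * Z.C1 := by
        rw [← ENNReal.div_le_iff' hne0 ENNReal.ofReal_ne_top]
        refine le_iInf fun G => le_iInf fun hG => le_iInf fun hdual => ?_
        rw [ENNReal.div_le_iff' hne0 ENNReal.ofReal_ne_top, ← ENNReal.ofReal_mul (by positivity)]
        exact ENNReal.ofReal_le_ofReal
          (Z.traceDist_condOn_le hσ hsym j hx he.le hw hw1 hG hdual)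
    _ < ENNReal.ofReal (n * a) * Z.C1 := by
        refine ENNReal.mul_lt_mul_left hC htop ?_
        rw [ENNReal.ofReal_lt_ofReal_iff (by nlinarith)]
        gcongr

end Conditional

/-! ### The main theorem. -/

/-- `j` is an arbitrary one of the `n` unmeasured copies of `H` (so `n ≥ 1`). -/
theorem mainTheorem3 {α β ζ : Type*} [Fintype α] [DecidableEq α] [Fintype β] [DecidableEq β]
    [Fintype ζ] [DecidableEq ζ] (n k : ℕ) (hk : 1 ≤ k) (j : Fin n)
    (ρ : Matrix (α × (Fin (n + k) → β)) (α × (Fin (n + k) → β)) ℂ) (hρ : IsDensity ρ)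
    (hexch : IsExchangeableRel (n + 2 * k - 1) ρ) (Z : POVM ζ β) (ε : ℝ) (hε : 0 ≤ ε) :
    1 - k * Real.exp (-ε ^ 2 / 2 + 1) ≤
      probOf (Z.outcomeDist ρ) {zbar : Fin k → ζ |
        ENNReal.ofReal (traceDist (Z.condOn ρ zbar)
            (ptraceRight (Z.condOn ρ zbar) ⊗ₖ
              piTensor fun _ : Fin n => singleSystem j (Z.condOn ρ zbar))) <
          ENNReal.ofReal (n / Real.sqrt k) * Z.C2 * ENNReal.ofReal ε ∧
        varDist (fun z => outcomeProb (Z.op z) (singleSystem j (Z.condOn ρ zbar))) (freq zbar) <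
          Real.sqrt (Fintype.card ζ / k) * ε} := by
  obtain ⟨-, r, hr, σ, hσ, hsym, rfl⟩ := hexch
  -- Exchangeability up to `n + 2k - 1` leaves `k - 1` extra copies; with one kept copy they form a
  -- tuple as long as the measured one.
  obtain rfl : k = r + 1 := by omega
  have hsum := Z.sum_outcomeDist hρ
  have hnonneg : ∀ x, 0 ≤ Z.outcomeDist (ptraceRight (splitLast σ)) x := fun x => by
    rw [← Z.sum_law j]
    exact Finset.sum_nonneg fun v _ => Z.law_nonneg hσ.1 j _
  have hcard : 0 < Fintype.card ζ := by
    rw [Fintype.card_pos_iff]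
    by_contra h
    rw [not_nonempty_iff] at h
    simp at hsum
  have hbad := sum_indicator_mean_varDist_ge_le (q := Z.law σ j) (Z.law_nonneg hσ.1 j)
    (Z.law_swapEntry hsym j) r.succ_pos hcard hε
  rw [Fintype.sum_prod_type] at hbad
  simp only [Z.sum_law, hsum, mul_one] at hbad
  set p := Z.outcomeDist (ptraceRight (splitLast σ)) with hp
  set a := Real.sqrt (Fintype.card ζ / (r + 1 : ℕ)) * ε with ha
  set B : Set (Fin (r + 1) → ζ) :=
    {x | a * p x ≤ ∑ v, Z.law σ j (x, v) * varDist (freq x) (freq v)} with hB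
  -- The argument yields failure probability at most `exp (1/2 - ε²/2)`, stronger than the stated
  -- bound.
  have hexp : Real.exp (1 / 2 - ε ^ 2 / 2) ≤ (r + 1 : ℕ) * Real.exp (-ε ^ 2 / 2 + 1) := by
    have h1 : (1 : ℝ) ≤ (r + 1 : ℕ) := by exact_mod_cast hk
    calc _ ≤ 1 * Real.exp (-ε ^ 2 / 2 + 1) := by
          rw [one_mul, Real.exp_le_exp]; linarith
      _ ≤ _ := by gcongr
  have hgood : ∀ x, x ∉ B → 0 < p x →
      ENNReal.ofReal (traceDist (Z.condOn (ptraceRight (splitLast σ)) x)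
        (ptraceRight (Z.condOn (ptraceRight (splitLast σ)) x) ⊗ₖ
          piTensor fun _ : Fin n => singleSystem j (Z.condOn (ptraceRight (splitLast σ)) x))) <
        ENNReal.ofReal (n / Real.sqrt (r + 1 : ℕ)) * Z.C2 * ENNReal.ofReal ε ∧
      varDist (fun z => outcomeProb (Z.op z)
        (singleSystem j (Z.condOn (ptraceRight (splitLast σ)) x))) (freq x) < a := by
    intro x hxB hpx
    have hw : ∀ v, 0 ≤ Z.condLaw σ j x v := fun v =>
      mul_nonneg (inv_nonneg.2 hpx.le) (Z.law_nonneg hσ.1 j _)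
    have hw1 : ∑ v, Z.condLaw σ j x v = 1 := by
      simp only [POVM.condLaw]
      rw [← Finset.mul_sum, Z.sum_law, inv_mul_cancel₀ hpx.ne']
    have hmean : ∑ v, Z.condLaw σ j x v * varDist (freq x) (freq v) < a := by
      simp only [POVM.condLaw, mul_assoc]
      rw [← Finset.mul_sum, inv_mul_lt_iff₀ hpx, mul_comm]
      exact not_le.1 hxB
    constructor
    · refine (Z.ofReal_traceDist_condOn_lt hσ.1 hsym j hpx hmean hw hw1).trans_eq ?_
      have hassoc : ∀ u v w : ℝ≥0∞, u * (v * Z.C1) * w = u * v * w * Z.C1 := fun u v w => by ring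
      rw [POVM.C2, hassoc, ← ENNReal.ofReal_mul (by positivity),
        ← ENNReal.ofReal_mul (by positivity), ha, Real.sqrt_div (Nat.cast_nonneg _)]
      congr 2
      ring
    · simp only [Z.outcomeProb_singleSystem_condOn hσ.1 hsym]
      exact (varDist_mean_le hw hw1 (fun v => freq v) (freq x)).trans_lt hmean
  rw [probOf]
  have hpt : ∀ x, p x ≤ B.indicator p x + Set.indicator {x |
      ENNReal.ofReal (traceDist (Z.condOn (ptraceRight (splitLast σ)) x)
        (ptraceRight (Z.condOn (ptraceRight (splitLast σ)) x) ⊗ₖ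
          piTensor fun _ : Fin n => singleSystem j (Z.condOn (ptraceRight (splitLast σ)) x))) <
        ENNReal.ofReal (n / Real.sqrt (r + 1 : ℕ)) * Z.C2 * ENNReal.ofReal ε ∧
      varDist (fun z => outcomeProb (Z.op z)
        (singleSystem j (Z.condOn (ptraceRight (splitLast σ)) x))) (freq x) < a} p x := by
    intro x
    by_cases hxB : x ∈ B
    · rw [Set.indicator_of_mem hxB]
      exact le_add_of_nonneg_right (Set.indicator_nonneg (fun x _ => hnonneg x) x)
    -- Outcomes of probability zero have no meaningful conditional state, but they carry no weight.
    · rcases (hnonneg x).eq_or_lt with h0 | hpx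
      · rw [← h0]
        exact add_nonneg (Set.indicator_nonneg (fun x _ => hnonneg x) x)
          (Set.indicator_nonneg (fun x _ => hnonneg x) x)
      · rw [Set.indicator_of_notMem hxB, Set.indicator_of_mem (by exact hgood x hxB hpx), zero_add]
  have h := Finset.sum_le_sum fun x (_ : x ∈ Finset.univ) => hpt x
  rw [hsum, Finset.sum_add_distrib] at h
  have hbad' : ∑ x, B.indicator p x ≤ Real.exp (1 / 2 - ε ^ 2 / 2) := hbad
  linarith
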